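/- Let $d\ge 1$, $q\ge 1$ and $p,p'\in[0,1]$ with $p<p'$. For a finite connected multigraph $G=(V,E)$ (loops and multiple edges allowed) and conductances $c:E\to(0,\infty)$, let $\Delta_c$ be the weighted graph Laplacian, $\Delta_c f(x)=\sum_{e=\{x,y\}} c_e\,(f(x)-f(y))$ (sum over the edges at $x$, with multiplicity), and let $\det\Delta_c$ be its determinant as a linear map on $\{f:V\to\mathbb R:\ \sum_{x} f(x)=0\}$. For $r\in[0,1]$ let $\mathbb P^{G,r}$ be the probability measure on $\{1,q\}^E$ with $$\mathbb P^{G,r}(\kappa)=\frac1Z\,\frac{r^{|\{e:\kappa_e=q\}|}(1-r)^{|\{e:\kappa_e=1\}|}}{\sqrt{\det\Delta_\kappa}},$$ where $Z$ is the normalising constant (for $q=1$ the two states "$1$" and "$q$" of an edge are still distinguished, so that $\mathbb P^{G,r}$ is Bernoulli percolation). Let $\Lambda_n=[-n,n]^d\cap\mathbb Z^d$ with the nearest-neighbour edges $E_n$ between its points, let $\partial\Lambda_n$ be the set of points of $\Lambda_n$ with a neighbour outside $\Lambda_n$, and let $\Lambda_n^w=\Lambda_n/\partial\Lambda_n$ be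 the multigraph, with the same edge set $E_n$, obtained by identifying all points of $\partial\Lambda_n$. Then the limits in the topology of local convergence (convergence of the probabilities of all events that depend on finitely many edges) $$\bar\mu^0_{p'}=\lim_{n\to\infty}\mathbb P^{\Lambda_n,p'},\qquad \bar\mu^1_{p}=\lim_{n\to\infty}\mathbb P^{\Lambda_n^w,p}$$ exist as unique probability measures on $\{1,q\}^{\mathbf E(\mathbb Z^d)}$, where $\mathbf E(\mathbb Z^d)$ is the set of nearest-neighbour edges of $\mathbb Z^d$, and for every $e\in\mathbf E(\mathbb Z^d)$ $$\bar\mu^0_{p'}(\kappa_e=q)\ \ge\ \bar\mu^1_{p}(\kappa_e=q).$$ -/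

import Mathlib

open Filter Topology MeasureTheory

namespace RandomConductance

/-! ### Finite multigraphs and the determinant of the weighted Laplacian -/

/-- A multigraph with vertex type `V` and edge type `E`. Each edge has two endpoints `tail e` and
`head e`; loops and multiple edges are allowed. The orientation is only a bookkeeping device. -/
structure Multigraph (V E : Type*) where
  /-- one endpoint of an edge -/
  tail : E → V
  /-- the other endpoint of an edge -/
  head : E → V

open Classical in
/-- The graph Laplacian with conductances `c`: the sum of `c e * (f x - f y)` over all edges `e`
at `x`, where `y` is the other endpoint of `e`. Loops contribute zero. -/
noncomputable def laplacian {V E : Type*} [Fintype E] (G : Multigraph V E) (c : E → ℝ) :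
    (V → ℝ) →ₗ[ℝ] (V → ℝ) where
  toFun f x := ∑ e, c e *
    ((if G.tail e = x then f x - f (G.head e) else 0) +
      (if G.head e = x then f x - f (G.tail e) else 0))
  map_add' f g := by
    funext x
    simp only [Pi.add_apply, ← Finset.sum_add_distrib]
    refine Finset.sum_congr rfl fun e _ => ?_
    split_ifs <;> ring
  map_smul' r f := by
    funext x
    simp only [Pi.smul_apply, smul_eq_mul, RingHom.id_apply, Finset.mul_sum]
    refine Finset.sum_congr rfl fun e _ => ?_
    split_ifs <;> ring

/-- The space `H₀` of functions on the vertices with vanishing average. -/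
def zeroSum (V : Type*) [Fintype V] : Submodule ℝ (V → ℝ) where
  carrier := {f | ∑ x, f x = 0}
  add_mem' {f g} hf hg := by
    simp only [Set.mem_ofPred_eq] at hf hg ⊢
    simp [Finset.sum_add_distrib, hf, hg]
  zero_mem' := by simp
  smul_mem' r f hf := by
    simp only [Set.mem_ofPred_eq] at hf ⊢
    simp [← Finset.mul_sum, hf]

theorem laplacian_mem_zeroSum {V E : Type*} [Fintype V] [Fintype E] (G : Multigraph V E)
    (c : E → ℝ) (f : V → ℝ) (_hf : f ∈ zeroSum V) : laplacian G c f ∈ zeroSum V := by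
  classical
  change ∑ x, laplacian G c f x = 0
  simp only [laplacian, LinearMap.coe_mk, AddHom.coe_mk]
  rw [Finset.sum_comm]
  refine Finset.sum_eq_zero fun e _ => ?_
  rw [← Finset.mul_sum, Finset.sum_add_distrib]
  simp

/-- `det Δ_c`: the determinant of the Laplacian as a linear endomorphism of `H₀`. -/
noncomputable def detLaplacian {V E : Type*} [Fintype V] [Fintype E] (G : Multigraph V E)
    (c : E → ℝ) : ℝ :=
  LinearMap.det ((laplacian G c).restrict (laplacian_mem_zeroSum G c))

/-! ### The random conductance model on a finite multigraph -/

/-- Configurations: `κ e = true` means that `e` is hard (conductance `q`), `κ e = false` means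
that `e` is soft (conductance `1`). -/
abbrev Config (E : Type*) := E → Bool

/-- The conductances in `{1, q}` encoded by a configuration. -/
def conductance {E : Type*} (q : ℝ) (κ : Config E) : E → ℝ :=
  fun e => if κ e = true then q else 1

/-- The number of hard edges. -/
def hardCount {E : Type*} [Fintype E] (κ : Config E) : ℕ :=
  (Finset.univ.filter fun e => κ e = true).card

/-- The number of soft edges. -/
def softCount {E : Type*} [Fintype E] (κ : Config E) : ℕ :=
  (Finset.univ.filter fun e => κ e = false).card

/-- The unnormalised weight `p ^ h(κ) * (1 - p) ^ s(κ) / √(det Δ_κ)`. -/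
noncomputable def weight {V E : Type*} [Fintype V] [Fintype E] (G : Multigraph V E) (q p : ℝ)
    (κ : Config E) : ℝ :=
  p ^ hardCount κ * (1 - p) ^ softCount κ / Real.sqrt (detLaplacian G (conductance q κ))

/-- The random conductance measure on `{1, q}^E` for a finite connected multigraph. -/
noncomputable def finiteMeasure {V E : Type*} [Fintype V] [Fintype E] [DecidableEq E]
    (G : Multigraph V E) (q p : ℝ) : Measure (Config E) :=
  ∑ κ : Config E,
    ENNReal.ofReal (weight G q p κ / ∑ κ' : Config E, weight G q p κ') • Measure.dirac κ

/-! ### Boxes in the integer lattice -/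

/-- The nearest neighbour bonds of `ℤ^d`: the pair `(x, i)` is the bond `{x, x + e_i}`, so every
unoriented bond is represented exactly once. -/
abbrev Bond (d : ℕ) := (Fin d → ℤ) × Fin d

/-- The endpoint `x` of the bond `{x, x + e_i}`. -/
def Bond.lo {d : ℕ} (e : Bond d) : Fin d → ℤ := e.1

/-- The endpoint `x + e_i` of the bond `{x, x + e_i}`. -/
def Bond.hi {d : ℕ} (e : Bond d) : Fin d → ℤ := e.1 + Pi.single e.2 1

/-- The box `Λ_n = [-n, n]^d ∩ ℤ^d`. -/
noncomputable def box (d n : ℕ) : Finset (Fin d → ℤ) := Finset.Icc (fun _ => -(n : ℤ)) (fun _ => (n : ℤ))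

/-- The bonds `E_n` with both endpoints in `Λ_n`. -/
noncomputable def boxBonds (d n : ℕ) : Finset (Bond d) :=
  (box d n ×ˢ (Finset.univ : Finset (Fin d))).filter fun e => Bond.hi e ∈ box d n

theorem mem_boxBonds {d n : ℕ} {e : Bond d} :
    e ∈ boxBonds d n ↔ Bond.lo e ∈ box d n ∧ Bond.hi e ∈ box d n := by
  simp [boxBonds, Bond.lo]

/-- The inner boundary `∂Λ_n`: the vertices of `Λ_n` that have a neighbour outside `Λ_n`. -/
def boxBoundary (d n : ℕ) : Set (box d n) :=
  {x | ∃ e : Bond d, (Bond.lo e = x ∧ Bond.hi e ∉ box d n) ∨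
    (Bond.hi e = x ∧ Bond.lo e ∉ box d n)}

/-- The graph `Λ_n` (free boundary conditions). -/
noncomputable def freeGraph (d n : ℕ) : Multigraph (box d n) (boxBonds d n) where
  tail e := ⟨Bond.lo e.1, (mem_boxBonds.1 e.2).1⟩
  head e := ⟨Bond.hi e.1, (mem_boxBonds.1 e.2).2⟩

/-- The equivalence relation that identifies all vertices of `W` and nothing else. -/
def contractSetoid {V : Type*} (W : Set V) : Setoid V where
  r x y := x = y ∨ (x ∈ W ∧ y ∈ W)
  iseqv := by
    refine ⟨fun x => Or.inl rfl, ?_, ?_⟩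
    · rintro x y (rfl | ⟨hx, hy⟩)
      · exact Or.inl rfl
      · exact Or.inr ⟨hy, hx⟩
    · rintro x y z (rfl | ⟨hx, hy⟩) (rfl | ⟨hy', hz⟩)
      · exact Or.inl rfl
      · exact Or.inr ⟨hy', hz⟩
      · exact Or.inr ⟨hx, hy⟩
      · exact Or.inr ⟨hx, hz⟩

/-- The vertex set of the contracted graph `G / W`. -/
abbrev ContractedVertex {V : Type*} (W : Set V) := Quotient (contractSetoid W)

open Classical in
noncomputable instance {V : Type*} [Fintype V] (W : Set V) : Fintype (ContractedVertex W) :=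
  Quotient.fintype _

/-- The contracted graph `G / W`: all vertices of `W` are identified, all edges are kept
(possibly as loops or multiple edges). -/
def Multigraph.contract {V E : Type*} (G : Multigraph V E) (W : Set V) :
    Multigraph (ContractedVertex W) E where
  tail e := Quotient.mk _ (G.tail e)
  head e := Quotient.mk _ (G.head e)

/-- The graph `Λ_n^w = Λ_n / ∂Λ_n` (wired boundary conditions). -/
noncomputable def wiredGraph (d n : ℕ) : Multigraph (ContractedVertex (boxBoundary d n)) (boxBonds d n) :=
  (freeGraph d n).contract (boxBoundary d n)

/-! ### Infinite volume measures -/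

/-- Extension of a configuration on `E_n` to all bonds of `ℤ^d`, soft outside `E_n`. Limits of
probabilities of local events do not depend on this choice. -/
noncomputable def softExtension {d n : ℕ} (κ : Config (boxBonds d n)) : Config (Bond d) :=
  fun e => if h : e ∈ boxBonds d n then κ ⟨e, h⟩ else false

/-- The free measure on `Λ_n`, as a measure on configurations on `ℤ^d`. -/
noncomputable def freeMeasure (d : ℕ) (q p : ℝ) (n : ℕ) : Measure (Config (Bond d)) :=
  (finiteMeasure (freeGraph d n) q p).map softExtension

/-- The wired measure on `Λ_n`, as a measure on configurations on `ℤ^d`. -/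
noncomputable def wiredMeasure (d : ℕ) (q p : ℝ) (n : ℕ) : Measure (Config (Bond d)) :=
  (finiteMeasure (wiredGraph d n) q p).map softExtension

/-- A local event: it belongs to the σ-algebra generated by finitely many coordinates. -/
def IsLocalEvent {E : Type*} (A : Set (Config E)) : Prop :=
  ∃ F : Finset E, MeasurableSet[cylinderEvents (F : Set E)] A

/-- Convergence of measures on configurations in the topology of local convergence. -/
def LocalTendsto {E : Type*} (ν : ℕ → Measure (Config E)) (μ : Measure (Config E)) : Prop :=
  ∀ A : Set (Config E), IsLocalEvent A → Tendsto (fun n => ν n A) atTop (𝓝 (μ A))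

/-- `μ` is the infinite volume measure with free boundary conditions. -/
def IsFreeLimit (d : ℕ) (q p : ℝ) (μ : Measure (Config (Bond d))) : Prop :=
  IsProbabilityMeasure μ ∧ LocalTendsto (freeMeasure d q p) μ

/-- `μ` is the infinite volume measure with wired boundary conditions. -/
def IsWiredLimit (d : ℕ) (q p : ℝ) (μ : Measure (Config (Bond d))) : Prop :=
  IsProbabilityMeasure μ ∧ LocalTendsto (wiredMeasure d q p) μ

end RandomConductance

/-! The determinant enters through one identity: raising the conductance of `e` by `s` multiplies
$\det\Delta_c$ by $1+sR_e$, where $R_e$ is the effective resistance of `e` (`exists_isResistance`).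
By Rayleigh monotonicity $R_e$ can only drop when the network is enlarged or vertices are
identified, so the determinant then reacts less to hardening (`detLaplacian_mul_le_of_energy_le`).
This is the lattice condition for Holley's inequality (`holley`). Hence the probability that given
edges are all hard increases with the box for free boundary conditions and decreases for wired ones.
These events determine a measure, so compactness yields the two limits.

For the densities, contract $\Lambda_n$ to $\Lambda_n^w$, which loses $K=O(n^{d-1})$ vertices. The
ratio of the two determinants is monotone in $\kappa$, and by homogeneity its oscillation is at most
a factor $q^K$. Up to its square root, the free measure at $p'$ is therefore the wired measure at
$p$ tilted by $\theta^{\#\text{hard}}$, where $\theta>1$ is the odds ratio of $p'$ and $p$. Jensen's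
inequality bounds $\log\theta$ times the excess of the expected number of hard edges (wired at $p$
minus free at $p'$) by $\frac K2\log q$ (`sum_hardProb_sub_le`). Monotonicity and lattice symmetry
compare every edge of the box with the limits: a wrong-way gap would make this excess of order
$n^d$, against a bound of order $n^{d-1}$. -/

namespace RandomConductance

/-! ### Energies and determinants -/

section Determinant

variable {V E : Type*} [Fintype E]

/-- The Dirichlet energy of `f` with conductances `c`. -/
noncomputable def energy (G : Multigraph V E) (c : E → ℝ) (f : V → ℝ) : ℝ :=
  ∑ e, c e * (f (G.tail e) - f (G.head e)) ^ 2

/-- Functions without increments along the edges are constant. -/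
def Multigraph.IsConnected (G : Multigraph V E) : Prop :=
  ∀ f : V → ℝ, (∀ e, f (G.tail e) = f (G.head e)) → ∀ x y, f x = f y

theorem energy_nonneg (G : Multigraph V E) {c : E → ℝ} (hc : ∀ e, 0 ≤ c e) (f : V → ℝ) :
    0 ≤ energy G c f :=
  Finset.sum_nonneg fun e _ => mul_nonneg (hc e) (sq_nonneg _)

theorem energy_add_single [DecidableEq E] (G : Multigraph V E) (c : E → ℝ) (s : ℝ) (e : E)
    (f : V → ℝ) :
    energy G (c + s • Pi.single e 1) f =
      energy G c f + s * (f (G.tail e) - f (G.head e)) ^ 2 := by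
  simp only [energy, Pi.add_apply, Pi.smul_apply, smul_eq_mul, add_mul, Finset.sum_add_distrib]
  congr 1
  rw [Finset.sum_eq_single e]
  · simp
  · intro k _ hk
    simp [hk]
  · simp

variable [Fintype V]

theorem sum_mul_laplacian (G : Multigraph V E) (c : E → ℝ) (f g : V → ℝ) :
    ∑ x, g x * laplacian G c f x =
      ∑ e, c e * ((g (G.tail e) - g (G.head e)) * (f (G.tail e) - f (G.head e))) := by
  classical
  simp only [laplacian, LinearMap.coe_mk, AddHom.coe_mk, Finset.mul_sum]
  rw [Finset.sum_comm]
  refine Finset.sum_congr rfl fun e _ => ?_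
  simp only [mul_left_comm _ (c e), mul_add, Finset.sum_add_distrib, mul_ite, mul_zero,
    Finset.sum_ite_eq, Finset.mem_univ, if_true]
  ring

theorem sum_mul_laplacian_self (G : Multigraph V E) (c : E → ℝ) (f : V → ℝ) :
    ∑ x, f x * laplacian G c f x = energy G c f := by
  rw [sum_mul_laplacian]
  exact Finset.sum_congr rfl fun e _ => by ring

/-- The Laplacian as an endomorphism of the functions with vanishing sum. -/
noncomputable def laplacianZero (G : Multigraph V E) (c : E → ℝ) : zeroSum V →ₗ[ℝ] zeroSum V :=
  (laplacian G c).restrict (laplacian_mem_zeroSum G c)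

theorem coe_laplacianZero (G : Multigraph V E) (c : E → ℝ) (f : zeroSum V) :
    (laplacianZero G c f : V → ℝ) = laplacian G c f := rfl

theorem detLaplacian_eq (G : Multigraph V E) (c : E → ℝ) :
    detLaplacian G c = LinearMap.det (laplacianZero G c) := rfl

theorem eq_zero_of_energy_eq_zero {G : Multigraph V E} (hG : G.IsConnected) {c : E → ℝ}
    (hc : ∀ e, 0 < c e) {f : V → ℝ} (hf : f ∈ zeroSum V) (h : energy G c f = 0) : f = 0 := by
  have h1 := (Finset.sum_eq_zero_iff_of_nonneg
    fun e _ => mul_nonneg (hc e).le (sq_nonneg _)).1 h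
  have h2 : ∀ x y, f x = f y := hG f fun e => by
    have := h1 e (Finset.mem_univ e)
    have := (mul_eq_zero.1 this).resolve_left (hc e).ne'
    exact sub_eq_zero.1 (pow_eq_zero_iff two_ne_zero |>.1 this)
  funext x
  have h3 : ∑ y, f y = 0 := hf
  rw [Finset.sum_congr rfl fun y _ => h2 y x] at h3
  simp only [Finset.sum_const, Finset.card_univ, nsmul_eq_mul, mul_eq_zero, Nat.cast_eq_zero,
    Fintype.card_eq_zero_iff] at h3
  exact h3.resolve_left fun h => h.elim x

/-- Deform the identity to the Laplacian by $(1-t)\,\mathrm{id}+t\Delta_c$. Pairing a kernel element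
with itself shows that every such map is injective, so the determinant never vanishes on the path
and keeps the sign it has at $t=0$. -/
theorem detLaplacian_pos {G : Multigraph V E} (hG : G.IsConnected) {c : E → ℝ}
    (hc : ∀ e, 0 < c e) : 0 < detLaplacian G c := by
  classical
  let T : ℝ → zeroSum V →ₗ[ℝ] zeroSum V := fun t => (1 - t) • LinearMap.id + t • laplacianZero G c
  have hne : ∀ t ∈ Set.Icc (0 : ℝ) 1, LinearMap.det (T t) ≠ 0 := by
    intro t ht h0
    obtain ⟨f, hf, hf0⟩ := (Submodule.ne_bot_iff _).1 (LinearMap.bot_lt_ker_of_det_eq_zero h0).ne'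
    have h1 : ∀ x, (1 - t) * (f : V → ℝ) x + t * laplacian G c f x = 0 := fun x =>
      congrFun (congrArg Subtype.val (LinearMap.mem_ker.1 hf)) x
    have h2 : (1 - t) * ∑ x, (f : V → ℝ) x ^ 2 + t * energy G c f = 0 := by
      rw [← sum_mul_laplacian_self, Finset.mul_sum, Finset.mul_sum, ← Finset.sum_add_distrib]
      refine Finset.sum_eq_zero fun x _ => ?_
      linear_combination (f : V → ℝ) x * h1 x
    have hE := energy_nonneg G (fun e => (hc e).le) (f : V → ℝ)
    have hS : 0 ≤ ∑ x, (f : V → ℝ) x ^ 2 := Finset.sum_nonneg fun x _ => sq_nonneg _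
    have h3 := mul_nonneg (sub_nonneg.2 ht.2) hS
    have h4 := mul_nonneg ht.1 hE
    apply hf0
    rcases eq_or_lt_of_le ht.1 with rfl | h
    · have : ∑ x, (f : V → ℝ) x ^ 2 = 0 := by linarith
      ext x
      have := (Finset.sum_eq_zero_iff_of_nonneg fun x _ => sq_nonneg _).1 this x (Finset.mem_univ x)
      exact pow_eq_zero_iff two_ne_zero |>.1 this
    · have : t * energy G c f = 0 := by linarith
      exact Subtype.ext (eq_zero_of_energy_eq_zero hG hc f.2
        ((mul_eq_zero.1 this).resolve_left h.ne'))
  have hcont : Continuous fun t => LinearMap.det (T t) := by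
    let b := Module.finBasis ℝ (zeroSum V)
    simp only [← LinearMap.det_toMatrix b]
    refine Continuous.matrix_det ?_
    simp only [T, map_add, map_smul]
    fun_prop
  have h0 : LinearMap.det (T 0) = 1 := by simp [T]
  have h1 : LinearMap.det (T 1) = detLaplacian G c := by simp [T, detLaplacian_eq]
  by_contra hneg
  obtain ⟨t, ht, ht0⟩ := intermediate_value_Icc' zero_le_one hcont.continuousOn
    (show (0 : ℝ) ∈ Set.Icc _ _ by rw [h0, h1]; exact ⟨not_lt.1 hneg, zero_le_one⟩)
  exact hne t ht ht0

open Classical in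
/-- The dipole at the endpoints of an edge. -/
noncomputable def dipole (G : Multigraph V E) (e : E) : zeroSum V :=
  ⟨fun x => (if G.tail e = x then 1 else 0) - (if G.head e = x then 1 else 0), by
    change ∑ x, _ = _
    simp [Finset.sum_sub_distrib]⟩

/-- The increment of a function along an edge. -/
def increment (G : Multigraph V E) (e : E) : zeroSum V →ₗ[ℝ] ℝ where
  toFun f := f.1 (G.tail e) - f.1 (G.head e)
  map_add' f g := by simp; ring
  map_smul' r f := by simp; ring

/-- `R` is the effective resistance of the edge `e`. -/
structure IsResistance (G : Multigraph V E) (c : E → ℝ) (e : E) (R : ℝ) : Prop where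
  nonneg : 0 ≤ R
  det_add [DecidableEq E] (s : ℝ) :
    detLaplacian G (c + s • Pi.single e 1) = detLaplacian G c * (1 + s * R)
  sq_le (f : V → ℝ) : (f (G.tail e) - f (G.head e)) ^ 2 ≤ R * energy G c f
  attained : ∃ u : V → ℝ, u (G.tail e) - u (G.head e) = R ∧ energy G c u = R

/-- The potential `u` of a unit current through `e` solves $\Delta_c u=$ dipole, and $R$ is its
increment along `e`, equal to its energy. Adding `s` at `e` composes $\Delta_c$ with a transvection
along `u` of determinant $1+sR$; the bound on increments is Cauchy–Schwarz. -/
theorem exists_isResistance {G : Multigraph V E} (hG : G.IsConnected) {c : E → ℝ}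
    (hc : ∀ e, 0 < c e) (e : E) : ∃ R, IsResistance G c e R := by
  classical
  have hu : IsUnit (LinearMap.det (laplacianZero G c)) := (detLaplacian_pos hG hc).ne'.isUnit
  let T := LinearEquiv.ofIsUnitDet (f := laplacianZero G c) (v := Module.finBasis ℝ (zeroSum V))
    (v' := Module.finBasis ℝ (zeroSum V)) (by rwa [LinearMap.det_toMatrix])
  have hT : ∀ f, T f = laplacianZero G c f := fun f => rfl
  let u := T.symm (dipole G e)
  have hTu : laplacianZero G c u = dipole G e := by rw [← hT]; exact T.apply_symm_apply _
  -- `u` represents the increment along `e` in the energy inner product.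
  have hpair : ∀ f : V → ℝ, f (G.tail e) - f (G.head e) =
      ∑ k, c k * ((f (G.tail k) - f (G.head k)) * (u.1 (G.tail k) - u.1 (G.head k))) := by
    intro f
    rw [← sum_mul_laplacian, ← coe_laplacianZero, hTu]
    simp [dipole, mul_sub, Finset.sum_sub_distrib]
  have hself : u.1 (G.tail e) - u.1 (G.head e) = energy G c u := by
    rw [hpair, energy]
    exact Finset.sum_congr rfl fun k _ => by ring
  refine ⟨increment G e u, ?_, ?_, ?_, u, rfl, hself.symm⟩
  · change 0 ≤ u.1 (G.tail e) - u.1 (G.head e)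
    exact hself ▸ energy_nonneg G (fun e => (hc e).le) u.1
  · intro _ s
    have hdec : laplacianZero G (c + s • Pi.single e 1) =
        laplacianZero G c ∘ₗ LinearMap.transvection (s • increment G e) u := by
      refine LinearMap.ext fun f => Subtype.ext ?_
      rw [LinearMap.comp_apply, LinearMap.transvection.apply, map_add, map_smul, hTu]
      funext x
      simp only [Submodule.coe_add, Submodule.coe_smul, Pi.add_apply, coe_laplacianZero,
        Pi.smul_apply, laplacian, LinearMap.coe_mk, AddHom.coe_mk, smul_eq_mul, add_mul,
        Finset.sum_add_distrib, LinearMap.smul_apply, increment, dipole]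
      congr 1
      rw [Finset.sum_eq_single e]
      · simp only [Pi.single_eq_same]
        split_ifs with h1 h2 h2 <;> simp [*]
        ring
      · intro k _ hk
        simp [hk]
      · simp
    rw [detLaplacian_eq, hdec, LinearMap.det_comp, LinearMap.transvection.det]
    rfl
  · intro f
    change _ ≤ (u.1 (G.tail e) - u.1 (G.head e)) * _
    rw [hself, hpair, mul_comm]
    have := Finset.sum_mul_sq_le_sq_mul_sq Finset.univ
      (fun k => √(c k) * (f (G.tail k) - f (G.head k)))
      (fun k => √(c k) * (u.1 (G.tail k) - u.1 (G.head k)))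
    refine le_trans (le_of_eq ?_) (this.trans (le_of_eq ?_))
    · congr 1
      refine Finset.sum_congr rfl fun k _ => ?_
      linear_combination -((f (G.tail k) - f (G.head k)) * (u.1 (G.tail k) - u.1 (G.head k))) *
        Real.mul_self_sqrt (hc k).le
    · simp only [energy, mul_pow, Real.sq_sqrt (hc _).le]

end Determinant

/-! ### Rayleigh monotonicity and comparison of determinants on two graphs -/

section Comparison

variable {V₁ V₂ E₁ E₂ : Type*} [Fintype V₁] [Fintype V₂] [Fintype E₁] [Fintype E₂]
  {G₁ : Multigraph V₁ E₁} {G₂ : Multigraph V₂ E₂} {c₁ : E₁ → ℝ} {c₂ : E₂ → ℝ}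

/-- Rayleigh monotonicity along a map of the vertices that does not increase energies. -/
theorem IsResistance.le_of_energy_le (φ : V₁ → V₂)
    (hE : ∀ f, energy G₁ c₁ (f ∘ φ) ≤ energy G₂ c₂ f) {e₁ : E₁} {e₂ : E₂}
    (ht : φ (G₁.tail e₁) = G₂.tail e₂) (hh : φ (G₁.head e₁) = G₂.head e₂) {R₁ R₂ : ℝ}
    (h₁ : IsResistance G₁ c₁ e₁ R₁) (h₂ : IsResistance G₂ c₂ e₂ R₂) : R₂ ≤ R₁ := by
  obtain ⟨u, hu, huE⟩ := h₂.attained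
  -- Testing with the optimal potential of the second graph gives $R_2^2\le R_1R_2$.
  have h := (h₁.sq_le (u ∘ φ)).trans (mul_le_mul_of_nonneg_left (hE u) h₁.nonneg)
  simp only [Function.comp_apply, ht, hh, hu, huE] at h
  rcases h₂.nonneg.eq_or_lt with h0 | h0
  · rw [← h0]; exact h₁.nonneg
  · rw [sq] at h
    exact le_of_mul_le_mul_right h h0

/-- Raise the conductances one edge at a time: the determinants gain factors $1+sR_1$ and $1+sR_2$,
with $R_2\le R_1$. Both energies gain the same term, so the energy comparison survives; it is
carried through the induction because each stage needs it. -/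
theorem detLaplacian_mul_le_of_energy_le [DecidableEq E₁] [DecidableEq E₂]
    (hG₁ : G₁.IsConnected) (hG₂ : G₂.IsConnected) (hc₁ : ∀ e, 0 < c₁ e) (hc₂ : ∀ e, 0 < c₂ e)
    (φ : V₁ → V₂) (hE : ∀ f, energy G₁ c₁ (f ∘ φ) ≤ energy G₂ c₂ f) {ι : Type*}
    (a : ι → E₁) (b : ι → E₂) (ht : ∀ k, φ (G₁.tail (a k)) = G₂.tail (b k))
    (hh : ∀ k, φ (G₁.head (a k)) = G₂.head (b k)) {s : ℝ} (hs : 0 ≤ s) (S : Finset ι) :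
    detLaplacian G₂ (c₂ + ∑ k ∈ S, s • Pi.single (b k) 1) * detLaplacian G₁ c₁ ≤
      detLaplacian G₁ (c₁ + ∑ k ∈ S, s • Pi.single (a k) 1) * detLaplacian G₂ c₂ := by
  classical
  have hpos₁ : ∀ S : Finset ι, ∀ e, 0 < (c₁ + ∑ k ∈ S, s • Pi.single (a k) 1 : E₁ → ℝ) e := by
    intro S e
    rw [Pi.add_apply, Finset.sum_apply]
    refine add_pos_of_pos_of_nonneg (hc₁ e) (Finset.sum_nonneg fun k _ => ?_)
    exact mul_nonneg hs (by rw [Pi.single_apply]; split_ifs <;> simp)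
  have hpos₂ : ∀ S : Finset ι, ∀ e, 0 < (c₂ + ∑ k ∈ S, s • Pi.single (b k) 1 : E₂ → ℝ) e := by
    intro S e
    rw [Pi.add_apply, Finset.sum_apply]
    refine add_pos_of_pos_of_nonneg (hc₂ e) (Finset.sum_nonneg fun k _ => ?_)
    exact mul_nonneg hs (by rw [Pi.single_apply]; split_ifs <;> simp)
  suffices h : (∀ f, energy G₁ (c₁ + ∑ k ∈ S, s • Pi.single (a k) 1) (f ∘ φ) ≤
      energy G₂ (c₂ + ∑ k ∈ S, s • Pi.single (b k) 1) f) ∧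
      detLaplacian G₂ (c₂ + ∑ k ∈ S, s • Pi.single (b k) 1) * detLaplacian G₁ c₁ ≤
      detLaplacian G₁ (c₁ + ∑ k ∈ S, s • Pi.single (a k) 1) * detLaplacian G₂ c₂ from h.2
  induction S using Finset.induction_on with
  | empty => simpa [mul_comm] using hE
  | insert k S hk ih =>
    obtain ⟨ihE, ihD⟩ := ih
    simp only [Finset.sum_insert hk, add_comm (s • _), ← add_assoc]
    refine ⟨fun f => ?_, ?_⟩
    · rw [energy_add_single, energy_add_single]
      simpa [ht, hh] using ihE f
    · obtain ⟨R₁, hR₁⟩ := exists_isResistance hG₁ (hpos₁ S) (a k)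
      obtain ⟨R₂, hR₂⟩ := exists_isResistance hG₂ (hpos₂ S) (b k)
      have hR := hR₁.le_of_energy_le φ ihE (ht k) (hh k) hR₂
      rw [hR₁.det_add, hR₂.det_add, mul_right_comm, mul_right_comm (detLaplacian G₁ _)]
      refine mul_le_mul ihD ?_ ?_ ?_
      · gcongr
      · exact add_nonneg zero_le_one (mul_nonneg hs hR₂.nonneg)
      · exact mul_nonneg (detLaplacian_pos hG₁ (hpos₁ S)).le (detLaplacian_pos hG₂ hc₂).le

end Comparison

/-! ### Stochastic domination -/

section Weights

variable {V E ι : Type*}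

/-- `κ'` arises from `κ` by making the distinct soft edges `a k`, `k ∈ S`, hard. -/
structure IsHardening (κ κ' : Config E) (a : ι ↪ E) (S : Finset ι) : Prop where
  soft : ∀ k ∈ S, κ (a k) = false
  iff : ∀ e, κ' e = true ↔ κ e = true ∨ e ∈ S.map a

theorem conductance_pos {q : ℝ} (hq : 1 ≤ q) (κ : Config E) (e : E) : 0 < conductance q κ e := by
  rw [conductance]
  split_ifs <;> linarith

theorem conductance_le {E' : Type*} {q : ℝ} (hq : 1 ≤ q) {κ : Config E} {κ' : Config E'} {e : E}
    {e' : E'} (h : κ e = true → κ' e' = true) : conductance q κ e ≤ conductance q κ' e' := by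
  rw [conductance, conductance]
  split_ifs <;> first | linarith | tauto

theorem IsHardening.conductance_eq [DecidableEq E] {κ κ' : Config E} {a : ι ↪ E} {S : Finset ι}
    (h : IsHardening κ κ' a S) (q : ℝ) :
    conductance q κ' = conductance q κ + ∑ k ∈ S, (q - 1) • Pi.single (a k) 1 := by
  classical
  funext e
  rw [Pi.add_apply, Finset.sum_apply]
  by_cases he : e ∈ S.map a
  · obtain ⟨k, hk, rfl⟩ := Finset.mem_map.1 he
    rw [Finset.sum_eq_single_of_mem k hk]
    · simp [conductance, (h.iff (a k)).2 (Or.inr he), h.soft k hk]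
    · intro l _ hl
      simp [a.injective.ne_iff.2 hl.symm]
  · rw [Finset.sum_eq_zero]
    · simp [conductance, h.iff e, he]
    · intro l hl
      have : e ≠ a l := fun h => he (h ▸ Finset.mem_map_of_mem a hl)
      simp [this]

variable [Fintype E]

theorem hardCount_add_softCount (κ : Config E) : hardCount κ + softCount κ = Fintype.card E := by
  classical
  rw [hardCount, softCount, ← Finset.card_univ,
    ← Finset.card_filter_add_card_filter_not (s := Finset.univ) (fun e => κ e = true)]
  simp

namespace IsHardening

variable {κ κ' : Config E} {a : ι ↪ E} {S : Finset ι}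

theorem hardCount_eq (h : IsHardening κ κ' a S) : hardCount κ' = hardCount κ + S.card := by
  classical
  rw [hardCount, hardCount, ← Finset.card_map a, ← Finset.card_union_of_disjoint]
  · congr 1
    ext e
    simp [h.iff e]
  · rw [Finset.disjoint_left]
    rintro e he heS
    obtain ⟨k, hk, rfl⟩ := Finset.mem_map.1 heS
    simp [h.soft k hk] at he

theorem softCount_eq (h : IsHardening κ κ' a S) : softCount κ = softCount κ' + S.card := by
  have h1 := hardCount_add_softCount κ
  have h2 := hardCount_add_softCount κ'
  have h3 := h.hardCount_eq
  omega

end IsHardening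

variable [Fintype V]

theorem weight_nonneg (G : Multigraph V E) (q : ℝ) {p : ℝ} (hp : 0 ≤ p) (hp' : p ≤ 1)
    (κ : Config E) : 0 ≤ weight G q p κ := by
  have := sub_nonneg.2 hp'
  unfold weight
  positivity

/-- The partition function. -/
noncomputable def partition [DecidableEq E] (G : Multigraph V E) (q p : ℝ) : ℝ :=
  ∑ κ : Config E, weight G q p κ

theorem partition_pos [DecidableEq E] {G : Multigraph V E} (hG : G.IsConnected) {q p : ℝ}
    (hq : 1 ≤ q) (hp : 0 ≤ p) (hp' : p ≤ 1) : 0 < partition G q p := by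
  have hD : ∀ κ : Config E, 0 < √(detLaplacian G (conductance q κ)) := fun κ =>
    Real.sqrt_pos.2 (detLaplacian_pos hG (conductance_pos hq κ))
  refine Finset.sum_pos' (fun κ _ => weight_nonneg G q hp hp' κ) ?_
  -- At $p=1$ the all-hard configuration has positive weight; for $p<1$, including $p=0$, the
  -- all-soft one does.
  rcases hp'.eq_or_lt with rfl | h
  · exact ⟨fun _ => true, Finset.mem_univ _, div_pos (by simp [softCount]) (hD _)⟩
  · refine ⟨fun _ => false, Finset.mem_univ _, div_pos ?_ (hD _)⟩
    simpa [hardCount] using pow_pos (sub_pos.2 h) _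

/-- The probability that all edges of `T` are hard. -/
noncomputable def hardProb [DecidableEq E] (G : Multigraph V E) (q p : ℝ) (T : Finset E) : ℝ :=
  (∑ κ : Config E, if ∀ e ∈ T, κ e = true then weight G q p κ else 0) / partition G q p

end Weights

/-- Holley's inequality for weights carried by two subsets of a distributive lattice. -/
theorem holley {L α₁ α₂ : Type*} [DistribLattice L] [Fintype L] [Fintype α₁] [Fintype α₂]
    {i₁ : α₁ → L} {i₂ : α₂ → L} (hi₁ : Function.Injective i₁) (hi₂ : Function.Injective i₂)
    {w₁ : α₁ → ℝ} {w₂ : α₂ → ℝ} (hw₁ : ∀ a, 0 ≤ w₁ a) (hw₂ : ∀ a, 0 ≤ w₂ a)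
    (h : ∀ a b, ∃ a' b', i₁ a' = i₁ a ⊓ i₂ b ∧ i₂ b' = i₁ a ⊔ i₂ b ∧
      w₁ a * w₂ b ≤ w₁ a' * w₂ b')
    (A : L → Prop) [DecidablePred A] (hA : ∀ x y, x ≤ y → A x → A y) :
    (∑ a, if A (i₁ a) then w₁ a else 0) * ∑ b, w₂ b ≤
      (∑ a, w₁ a) * ∑ b, if A (i₂ b) then w₂ b else 0 := by
  classical
  -- Both weights are extended by zero to all of `L`, where the four functions theorem applies;
  -- since `A` is increasing, its indicator may move from `x` to `x ⊔ y`.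
  let F₁ : L → ℝ := Function.extend i₁ w₁ 0
  let F₂ : L → ℝ := Function.extend i₂ w₂ 0
  have hF₁ : ∀ a, F₁ (i₁ a) = w₁ a := fun a => hi₁.extend_apply _ _ _
  have hF₂ : ∀ a, F₂ (i₂ a) = w₂ a := fun a => hi₂.extend_apply _ _ _
  have hF₁' : ∀ x ∉ Set.range i₁, F₁ x = 0 := fun x hx => Function.extend_apply' _ _ _ hx
  have hF₂' : ∀ x ∉ Set.range i₂, F₂ x = 0 := fun x hx => Function.extend_apply' _ _ _ hx
  have h₁ : 0 ≤ F₁ := fun x => by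
    by_cases hx : x ∈ Set.range i₁
    · obtain ⟨a, rfl⟩ := hx; rw [hF₁]; exact hw₁ a
    · rw [hF₁' x hx]; rfl
  have h₂ : 0 ≤ F₂ := fun x => by
    by_cases hx : x ∈ Set.range i₂
    · obtain ⟨a, rfl⟩ := hx; rw [hF₂]; exact hw₂ a
    · rw [hF₂' x hx]; rfl
  have key := four_functions_theorem_univ (fun x => if A x then F₁ x else 0) F₂ F₁
    (fun x => if A x then F₂ x else 0) (fun x => by dsimp; split_ifs; exacts [h₁ x, le_rfl]) h₂ h₁
    (fun x => by dsimp; split_ifs; exacts [h₂ x, le_rfl]) (by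
      intro x y
      have hnn : 0 ≤ F₁ (x ⊓ y) * (if A (x ⊔ y) then F₂ (x ⊔ y) else 0) :=
        mul_nonneg (h₁ _) (by split_ifs; exacts [h₂ _, le_rfl])
      split_ifs at hnn ⊢ with hx hxy
      · by_cases hxr : x ∈ Set.range i₁
        · by_cases hyr : y ∈ Set.range i₂
          · obtain ⟨a, rfl⟩ := hxr
            obtain ⟨b, rfl⟩ := hyr
            obtain ⟨a', b', ha', hb', hw⟩ := h a b
            rwa [← ha', ← hb', hF₁, hF₁, hF₂, hF₂]
          · rwa [hF₂' y hyr, mul_zero]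
        · rwa [hF₁' x hxr, zero_mul]
      · exact absurd (hA _ _ le_sup_left hx) hxy
      · simpa using hnn
      · simp)
  rwa [← Fintype.sum_of_injective i₁ hi₁ (fun a => if A (i₁ a) then w₁ a else 0)
      (fun x => if A x then F₁ x else 0) (fun x hx => by simp [hF₁' x hx]) (by simp [hF₁]),
    ← Fintype.sum_of_injective i₂ hi₂ (fun a => if A (i₂ a) then w₂ a else 0)
      (fun x => if A x then F₂ x else 0) (fun x hx => by simp [hF₂' x hx]) (by simp [hF₂]),
    ← Fintype.sum_of_injective i₁ hi₁ w₁ F₁ hF₁' (fun a => (hF₁ a).symm),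
    ← Fintype.sum_of_injective i₂ hi₂ w₂ F₂ hF₂' (fun a => (hF₂ a).symm)] at key

/-! ### Monotonicity of the finite measures under changes of the graph -/

section Comparison

variable {V₁ V₂ E₁ E₂ : Type*} [Fintype V₁] [Fintype V₂] [Fintype E₁] [Fintype E₂]
  {G₁ : Multigraph V₁ E₁} {G₂ : Multigraph V₂ E₂} {q p : ℝ}

/-- The lattice condition for Holley's inequality. Both hardenings flip `S.card` edges, so the
Bernoulli factors agree and only the determinants are compared. -/
theorem weight_mul_weight_le (hG₁ : G₁.IsConnected) (hG₂ : G₂.IsConnected) (hq : 1 ≤ q)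
    (hp : 0 ≤ p) (hp' : p ≤ 1) (φ : V₁ → V₂) {ι : Type*} {a : ι ↪ E₁} {b : ι ↪ E₂}
    (ht : ∀ k, φ (G₁.tail (a k)) = G₂.tail (b k)) (hh : ∀ k, φ (G₁.head (a k)) = G₂.head (b k))
    {S : Finset ι} {κ₁ κ₁' : Config E₁} {κ₂ κ₂' : Config E₂}
    (h₁ : IsHardening κ₁ κ₁' a S) (h₂ : IsHardening κ₂ κ₂' b S)
    (hE : ∀ f, energy G₁ (conductance q κ₁) (f ∘ φ) ≤ energy G₂ (conductance q κ₂) f) :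
    weight G₁ q p κ₁' * weight G₂ q p κ₂ ≤ weight G₁ q p κ₁ * weight G₂ q p κ₂' := by
  classical
  have hD := detLaplacian_mul_le_of_energy_le hG₁ hG₂ (conductance_pos hq κ₁)
    (conductance_pos hq κ₂) φ hE a b ht hh (sub_nonneg.2 hq) S
  rw [← h₁.conductance_eq, ← h₂.conductance_eq] at hD
  have hp1 := sub_nonneg.2 hp'
  have hD₁ := detLaplacian_pos hG₁ (conductance_pos hq κ₁)
  have hD₂ := detLaplacian_pos hG₂ (conductance_pos hq κ₂')
  unfold weight
  rw [h₁.hardCount_eq, h₂.hardCount_eq, h₁.softCount_eq, h₂.softCount_eq, div_mul_div_comm,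
    div_mul_div_comm, ← Real.sqrt_mul' _ (detLaplacian_pos hG₂ (conductance_pos hq κ₂)).le,
    ← Real.sqrt_mul' _ hD₂.le]
  have hnum : p ^ (hardCount κ₁ + S.card) * (1 - p) ^ softCount κ₁' *
      (p ^ hardCount κ₂ * (1 - p) ^ (softCount κ₂' + S.card)) =
      p ^ hardCount κ₁ * (1 - p) ^ (softCount κ₁' + S.card) *
      (p ^ (hardCount κ₂ + S.card) * (1 - p) ^ softCount κ₂') := by ring
  rw [hnum]
  refine div_le_div_of_nonneg_left (by positivity) (Real.sqrt_pos.2 (mul_pos hD₁ hD₂)) ?_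
  exact Real.sqrt_le_sqrt (by linarith)

/-- Adding edges and vertices makes the common edges harder. -/
theorem hardProb_le_hardProb_of_embedding [DecidableEq E₁] [DecidableEq E₂]
    (hG₁ : G₁.IsConnected) (hG₂ : G₂.IsConnected)
    (hq : 1 ≤ q) (hp : 0 ≤ p) (hp' : p ≤ 1) (φ : V₁ → V₂) (j : E₁ ↪ E₂)
    (ht : ∀ k, φ (G₁.tail k) = G₂.tail (j k)) (hh : ∀ k, φ (G₁.head k) = G₂.head (j k))
    (T : Finset E₁) : hardProb G₁ q p T ≤ hardProb G₂ q p (T.map j) := by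
  unfold hardProb
  rw [div_le_div_iff₀ (partition_pos hG₁ hq hp hp') (partition_pos hG₂ hq hp hp'),
    mul_comm _ (partition G₁ q p)]
  have hext : ∀ κ : Config E₁, ∀ k, Function.extend j κ (fun _ => false) (j k) = κ k :=
    fun κ k => j.injective.extend_apply _ _ _
  have hext' : ∀ κ : Config E₁, ∀ e, (¬∃ k, j k = e) →
      Function.extend j κ (fun _ => false) e = false :=
    fun κ e he => Function.extend_apply' _ _ _ he
  -- The extension is soft on the new edges, so a meet with it is again such an extension.
  have key := holley (L := Config E₂) (i₁ := fun κ : Config E₁ => Function.extend j κ fun _ => false)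
    (i₂ := id) (fun κ κ' h => funext fun k => by rw [← hext κ, ← hext κ']; exact congrFun h (j k))
    Function.injective_id (weight_nonneg G₁ q hp hp') (weight_nonneg G₂ q hp hp') ?_
    (fun κ => ∀ e ∈ T.map j, κ e = true) (fun x y hxy hx e he => by
      have := hxy e
      rw [hx e he] at this
      exact top_le_iff.1 this)
  · simpa only [Finset.mem_map, forall_exists_index, and_imp, forall_apply_eq_imp_iff₂, hext, id,
      partition] using key
  · intro κ κ'
    refine ⟨fun k => κ k && κ' (j k), Function.extend j κ (fun _ => false) ⊔ κ', ?_, rfl, ?_⟩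
    · funext e
      by_cases he : ∃ k, j k = e
      · obtain ⟨k, rfl⟩ := he
        simp [hext]
      · simp [hext' _ _ he]
    -- The same edges, hard in `κ` and soft in `κ'`, lead from the meet to `κ` and from `κ'` to the
    -- join.
    · refine weight_mul_weight_le hG₁ hG₂ hq hp hp' φ (a := .refl E₁) (b := j) ht hh
        (S := Finset.univ.filter fun k => κ k = true ∧ κ' (j k) = false) ⟨?_, ?_⟩ ⟨?_, ?_⟩ ?_
      · intro k hk
        simp_all
      · intro k
        cases h : κ' (j k) <;> simp [h]
      · intro k hk
        simp_all
      · intro e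
        by_cases he : ∃ k, j k = e
        · obtain ⟨k, rfl⟩ := he
          cases h : κ' (j k) <;> simp [h, hext]
        · have : ∀ k, j k ≠ e := not_exists.1 he
          simp [this]
      · intro f
        unfold energy
        simp only [Function.comp_apply, ht, hh]
        calc _ ≤ ∑ k, conductance q κ' (j k) * (f (G₂.tail (j k)) - f (G₂.head (j k))) ^ 2 := by
              gcongr with k
              exact conductance_le hq (by simp)
          _ = ∑ e ∈ Finset.univ.map j,
              conductance q κ' e * (f (G₂.tail e) - f (G₂.head e)) ^ 2 := by
              rw [Finset.sum_map]
          _ ≤ _ := Finset.sum_le_univ_sum_of_nonneg fun e =>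
              mul_nonneg (conductance_pos hq κ' e).le (sq_nonneg _)

/-- Identifying vertices in such a way that the edges outside a given set become loops makes the
remaining edges harder. -/
theorem hardProb_le_hardProb_of_collapse [DecidableEq E₁] [DecidableEq E₂]
    (hG₁ : G₁.IsConnected) (hG₂ : G₂.IsConnected)
    (hq : 1 ≤ q) (hp : 0 ≤ p) (hp' : p ≤ 1) (φ : V₁ → V₂) (j : E₂ ↪ E₁)
    (ht : ∀ k, φ (G₁.tail (j k)) = G₂.tail k) (hh : ∀ k, φ (G₁.head (j k)) = G₂.head k)
    (hloop : ∀ e, (¬∃ k, j k = e) → φ (G₁.tail e) = φ (G₁.head e))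
    (T : Finset E₂) : hardProb G₁ q p (T.map j) ≤ hardProb G₂ q p T := by
  unfold hardProb
  rw [div_le_div_iff₀ (partition_pos hG₁ hq hp hp') (partition_pos hG₂ hq hp hp'),
    mul_comm _ (partition G₁ q p)]
  have hext : ∀ κ : Config E₂, ∀ k, Function.extend j κ (fun _ => true) (j k) = κ k :=
    fun κ k => j.injective.extend_apply _ _ _
  have hext' : ∀ κ : Config E₂, ∀ e, (¬∃ k, j k = e) →
      Function.extend j κ (fun _ => true) e = true :=
    fun κ e he => Function.extend_apply' _ _ _ he
  -- Dually, the extension is hard on the collapsed edges, so a join with it stays in the image.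
  have key := holley (L := Config E₁) (i₁ := id)
    (i₂ := fun κ : Config E₂ => Function.extend j κ fun _ => true) Function.injective_id
    (fun κ κ' h => funext fun k => by rw [← hext κ, ← hext κ']; exact congrFun h (j k))
    (weight_nonneg G₁ q hp hp') (weight_nonneg G₂ q hp hp') ?_
    (fun κ => ∀ e ∈ T.map j, κ e = true) (fun x y hxy hx e he => by
      have := hxy e
      rw [hx e he] at this
      exact top_le_iff.1 this)
  · simpa only [Finset.mem_map, forall_exists_index, and_imp, forall_apply_eq_imp_iff₂, hext, id,
      partition] using key
  · intro κ κ'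
    refine ⟨κ ⊓ Function.extend j κ' (fun _ => true), fun k => κ (j k) || κ' k, rfl, ?_, ?_⟩
    · funext e
      by_cases he : ∃ k, j k = e
      · obtain ⟨k, rfl⟩ := he
        simp [hext]
      · simp [hext' _ _ he]
    · refine weight_mul_weight_le hG₁ hG₂ hq hp hp' φ (a := j) (b := .refl E₂) ht hh
        (S := Finset.univ.filter fun k => κ (j k) = true ∧ κ' k = false) ⟨?_, ?_⟩ ⟨?_, ?_⟩ ?_
      · intro k hk
        simp_all
      · intro e
        by_cases he : ∃ k, j k = e
        · obtain ⟨k, rfl⟩ := he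
          cases h : κ' k <;> simp [h, hext]
        · have : ∀ k, j k ≠ e := not_exists.1 he
          simp [this]
      · intro k hk
        simp_all
      · intro k
        cases h : κ' k <;> simp [h]
      · intro f
        -- Collapsed edges are loops and carry no energy, so their state is irrelevant here.
        refine le_of_eq_of_le (Fintype.sum_of_injective j j.injective (fun k =>
          conductance q (κ ⊓ Function.extend j κ' fun _ => true) (j k) *
            (f (G₂.tail k) - f (G₂.head k)) ^ 2) _ ?_ ?_).symm ?_
        · intro e he
          simp [hloop e he]
        · intro k
          simp [ht, hh]
        · unfold energy
          gcongr with k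
          exact conductance_le hq (by simp [hext])

end Comparison

/-! ### Boxes -/

section Boxes

variable {d : ℕ}

theorem mem_box {n : ℕ} {x : Fin d → ℤ} : x ∈ box d n ↔ ∀ i, -(n : ℤ) ≤ x i ∧ x i ≤ n := by
  simp [box, Pi.le_def, forall_and]

theorem box_mono {n m : ℕ} (h : n ≤ m) : box d n ⊆ box d m := fun x hx => mem_box.2 fun i => by
  have := mem_box.1 hx i
  omega

theorem exists_mem_box (x : Fin d → ℤ) : ∃ n, x ∈ box d n :=
  ⟨∑ i, (x i).natAbs, mem_box.2 fun i => by
    have := Finset.single_le_sum (f := fun i => (x i).natAbs) (fun i _ => Nat.zero_le _)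
      (Finset.mem_univ i)
    omega⟩

theorem hi_apply (e : Bond d) (i : Fin d) : e.hi i = e.lo i + if i = e.2 then 1 else 0 := by
  simp [Bond.hi, Bond.lo, Pi.single_apply]

/-- Every vertex can walk to the lowest corner inside the box by lowering one coordinate at a time;
the induction is on the $\ell^1$ distance to that corner. -/
theorem freeGraph_isConnected (d n : ℕ) : (freeGraph d n).IsConnected := by
  intro f hf
  let x₀ : box d n := ⟨fun _ => -(n : ℤ), mem_box.2 fun i => by simp⟩
  suffices h : ∀ k : ℕ, ∀ x : box d n, ∑ i, (x.1 i + n).toNat = k → f x = f x₀ from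
    fun x y => (h _ x rfl).trans (h _ y rfl).symm
  intro k
  induction k using Nat.strong_induction_on with
  | _ k ih =>
    intro x hx
    by_cases hx0 : x = x₀
    · rw [hx0]
    · obtain ⟨i, hi⟩ : ∃ i, x.1 i ≠ -(n : ℤ) := by
        by_contra! hcon
        exact hx0 (Subtype.ext (funext hcon))
      have hxb := mem_box.1 x.2
      let e : Bond d := (x.1 - Pi.single i 1, i)
      have hhi : e.hi = x.1 := by simp [e, Bond.hi]
      have hloi : ∀ l, e.lo l = x.1 l - if l = i then 1 else 0 := fun l => by
        simp [e, Bond.lo, Pi.single_apply]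
      have hlo : e.lo ∈ box d n := mem_box.2 fun l => by
        rw [hloi]
        have := hxb l
        split_ifs with h
        · subst h; omega
        · omega
      have he : e ∈ boxBonds d n := mem_boxBonds.2 ⟨hlo, hhi ▸ x.2⟩
      have h1 : f ⟨e.lo, hlo⟩ = f x := (hf ⟨e, he⟩).trans (congrArg f (Subtype.ext hhi))
      rw [← h1]
      refine ih _ ?_ _ rfl
      rw [← hx]
      refine Finset.sum_lt_sum (fun l _ => ?_) ⟨i, Finset.mem_univ i, ?_⟩
      · change (e.lo l + n).toNat ≤ _
        rw [hloi]
        split_ifs <;> omega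
      · change (e.lo i + n).toNat < _
        rw [hloi, if_pos rfl]
        have := hxb i
        omega

theorem wiredGraph_isConnected (d n : ℕ) : (wiredGraph d n).IsConnected := by
  intro f hf x y
  induction x using Quotient.inductionOn with | _ x => ?_
  induction y using Quotient.inductionOn with | _ y => ?_
  exact freeGraph_isConnected d n (fun x => f (Quotient.mk _ x)) hf x y

theorem exists_mem_boxBoundary (hd : 1 ≤ d) (n : ℕ) : ∃ x, x ∈ boxBoundary d n := by
  refine ⟨⟨fun _ => n, mem_box.2 fun i => by simp⟩, (fun _ => (n : ℤ), ⟨0, hd⟩),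
    Or.inl ⟨rfl, fun h => ?_⟩⟩
  have := (mem_box.1 h ⟨0, hd⟩).2
  rw [hi_apply] at this
  simp [Bond.lo] at this

/-- Automorphisms of the oriented lattice `ℤ^d`. -/
structure LatticeAut (d : ℕ) where
  /-- the action on vertices -/
  vert : (Fin d → ℤ) ≃ (Fin d → ℤ)
  /-- the action on bonds -/
  bond : Bond d ≃ Bond d
  lo_bond : ∀ e, (bond e).lo = vert e.lo
  hi_bond : ∀ e, (bond e).hi = vert e.hi

/-- The identity automorphism. -/
def LatticeAut.refl (d : ℕ) : LatticeAut d := ⟨.refl _, .refl _, fun _ => rfl, fun _ => rfl⟩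

/-- Exchange of two coordinates followed by a translation. -/
def LatticeAut.swapAdd (k l : Fin d) (a : Fin d → ℤ) : LatticeAut d where
  vert := (Equiv.arrowCongr (Equiv.swap k l) (Equiv.refl ℤ)).trans (Equiv.addRight a)
  bond := Equiv.prodCongr
    ((Equiv.arrowCongr (Equiv.swap k l) (Equiv.refl ℤ)).trans (Equiv.addRight a)) (Equiv.swap k l)
  lo_bond _ := rfl
  hi_bond e := by
    funext i
    simp [Bond.hi, Pi.single_apply, Equiv.swap_apply_eq_iff, add_right_comm]

theorem LatticeAut.swapAdd_vert_apply (k l : Fin d) (a x : Fin d → ℤ) (i : Fin d) :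
    (swapAdd k l a).vert x i = x (Equiv.swap k l i) + a i := rfl

/-- Any bond of `Λ_n` is mapped to a given bond `e` by an automorphism under which the image of
`Λ_n` is not too large. -/
theorem exists_latticeAut (e : Bond d) :
    ∃ N, ∀ n, ∀ e' ∈ boxBonds d n, ∃ g : LatticeAut d, g.bond e' = e ∧
      ∀ x ∈ box d n, g.vert x ∈ box d (2 * n + N) := by
  obtain ⟨N, hN⟩ := exists_mem_box e.1
  -- The swap matches the directions and the translation the base points. The box radius adds `n`
  -- for `x`, `n` for `e'` and `N` for `e`.
  refine ⟨N, fun n e' he' => ⟨.swapAdd e'.2 e.2 (fun i => e.1 i - e'.1 (Equiv.swap e'.2 e.2 i)),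
    ?_, fun x hx => mem_box.2 fun i => ?_⟩⟩
  · refine Prod.ext (funext fun i => ?_) ?_
    · exact (LatticeAut.swapAdd_vert_apply _ _ _ _ i).trans (by ring)
    · exact Equiv.swap_apply_left _ _
  · rw [LatticeAut.swapAdd_vert_apply]
    have h1 := mem_box.1 hN i
    have h2 := mem_box.1 hx (Equiv.swap e'.2 e.2 i)
    have h3 := mem_box.1 (mem_boxBonds.1 he').1 (Equiv.swap e'.2 e.2 i)
    simp only [Bond.lo] at h3
    push_cast
    omega

/-- The map between the bonds of boxes induced by a lattice automorphism. -/
def LatticeAut.boxBond (g : LatticeAut d) {n m : ℕ} (hg : ∀ x ∈ box d n, g.vert x ∈ box d m) :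
    boxBonds d n ↪ boxBonds d m where
  toFun e := ⟨g.bond e, mem_boxBonds.2 ⟨g.lo_bond e ▸ hg _ (mem_boxBonds.1 e.2).1,
    g.hi_bond e ▸ hg _ (mem_boxBonds.1 e.2).2⟩⟩
  inj' _ _ h := Subtype.ext (g.bond.injective (congrArg Subtype.val h))

variable {q p : ℝ}

theorem hardProb_freeGraph_le (hq : 1 ≤ q) (hp : 0 ≤ p) (hp' : p ≤ 1) (g : LatticeAut d)
    {n m : ℕ} (hg : ∀ x ∈ box d n, g.vert x ∈ box d m) (T : Finset (boxBonds d n)) :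
    hardProb (freeGraph d n) q p T ≤ hardProb (freeGraph d m) q p (T.map (g.boxBond hg)) :=
  hardProb_le_hardProb_of_embedding (freeGraph_isConnected d n) (freeGraph_isConnected d m) hq hp
    hp' (fun x => ⟨g.vert x, hg x x.2⟩) (g.boxBond hg) (fun e => Subtype.ext (g.lo_bond e).symm)
    (fun e => Subtype.ext (g.hi_bond e).symm) T

/-- Collapsing everything outside the image of $\Lambda_n$ to the boundary vertex turns the larger
wired box into the smaller one. -/
theorem hardProb_wiredGraph_le (hd : 1 ≤ d) (hq : 1 ≤ q) (hp : 0 ≤ p) (hp' : p ≤ 1)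
    (g : LatticeAut d) {n m : ℕ} (hg : ∀ x ∈ box d n, g.vert x ∈ box d m)
    (T : Finset (boxBonds d n)) :
    hardProb (wiredGraph d m) q p (T.map (g.boxBond hg)) ≤ hardProb (wiredGraph d n) q p T := by
  classical
  obtain ⟨b, hb⟩ := exists_mem_boxBoundary hd n
  let ψ : box d m → ContractedVertex (boxBoundary d n) := fun x =>
    if h : g.vert.symm x ∈ box d n then Quotient.mk _ ⟨g.vert.symm x, h⟩ else Quotient.mk _ b
  have hout : ∀ x : box d m, (∀ h : g.vert.symm x ∈ box d n,
      (⟨g.vert.symm x, h⟩ : box d n) ∈ boxBoundary d n) → ψ x = Quotient.mk _ b := by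
    intro x hx
    by_cases h : g.vert.symm x ∈ box d n
    · simp only [ψ, dif_pos h]
      exact Quotient.sound (Or.inr ⟨hx h, hb⟩)
    · simp only [ψ, dif_neg h]
  have hlo : ∀ e : Bond d, g.vert.symm e.lo = (g.bond.symm e).lo := fun e => by
    rw [Equiv.symm_apply_eq, ← g.lo_bond, Equiv.apply_symm_apply]
  have hhi : ∀ e : Bond d, g.vert.symm e.hi = (g.bond.symm e).hi := fun e => by
    rw [Equiv.symm_apply_eq, ← g.hi_bond, Equiv.apply_symm_apply]
  -- This lets `ψ` descend to the quotient by $\partial\Lambda_m$.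
  have hbd : ∀ x ∈ boxBoundary d m, ψ x = Quotient.mk _ b := by
    rintro x ⟨e, ⟨he, he'⟩ | ⟨he, he'⟩⟩ <;> refine hout x fun h => ⟨g.bond.symm e, ?_⟩
    · refine Or.inl ⟨?_, fun h' => he' ?_⟩
      · rw [← hlo, he]
      · rw [← hhi] at h'
        simpa using hg _ h'
    · refine Or.inr ⟨?_, fun h' => he' ?_⟩
      · rw [← hhi, he]
      · rw [← hlo] at h'
        simpa using hg _ h'
  have hin : ∀ x : box d n, ψ ⟨g.vert x, hg x x.2⟩ = Quotient.mk _ x := fun x => by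
    simp [ψ]
  refine hardProb_le_hardProb_of_collapse (wiredGraph_isConnected d m) (wiredGraph_isConnected d n)
    hq hp hp' (Quotient.lift ψ ?_) _ ?_ ?_ ?_ T
  · rintro x y (rfl | ⟨hx, hy⟩)
    · rfl
    · rw [hbd x hx, hbd y hy]
  · intro e
    refine Eq.trans (congrArg ψ (Subtype.ext ?_)) (hin _)
    exact g.lo_bond e
  · intro e
    refine Eq.trans (congrArg ψ (Subtype.ext ?_)) (hin _)
    exact g.hi_bond e
  -- One endpoint of such a bond lies outside the image of $\Lambda_n$; the other is outside too or
  -- has an outside neighbour. Both go to the boundary vertex.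
  · intro e he
    have he' : g.bond.symm e ∉ boxBonds d n := fun h =>
      he ⟨⟨g.bond.symm e, h⟩, Subtype.ext (g.bond.apply_symm_apply _)⟩
    rw [mem_boxBonds, not_and] at he'
    refine (hout ⟨e.1.lo, _⟩ fun h => ?_).trans (hout ⟨e.1.hi, _⟩ fun h => ?_).symm
    · exact ⟨g.bond.symm e, Or.inl ⟨(hlo e).symm, he' (hlo e ▸ h)⟩⟩
    · exact ⟨g.bond.symm e, Or.inr ⟨(hhi e).symm, fun h' => he' h' (hhi e ▸ h)⟩⟩

theorem card_box (d n : ℕ) : (box d n).card = (2 * n + 1) ^ d := by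
  rw [box, Pi.card_Icc]
  simp only [Int.card_Icc, Finset.prod_const, Finset.card_univ, Fintype.card_fin]
  congr 1
  omega

/-- Each vertex starts a bond in the first direction; radius `n + 1` makes room for its far end. -/
theorem card_box_le_card_boxBonds (hd : 1 ≤ d) (n : ℕ) :
    (box d n).card ≤ (boxBonds d (n + 1)).card := by
  refine Finset.card_le_card_of_injOn (fun x => (x, ⟨0, hd⟩)) (fun x hx => ?_)
    fun x _ y _ h => congrArg Prod.fst h
  refine Finset.mem_coe.2 (mem_boxBonds.2 ⟨box_mono (n.le_add_right 1) hx, mem_box.2 fun i => ?_⟩)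
  have := mem_box.1 hx i
  rw [hi_apply]
  simp only [Bond.lo]
  split_ifs <;> push_cast <;> omega

/-- The boundary of $\Lambda_{n+1}$ avoids $\Lambda_n$ and contraction is injective off it, so at
most $|\Lambda_{n+1}\setminus\Lambda_n|$ vertices are lost. -/
theorem card_le_card_contractedVertex_add (d n : ℕ) :
    Fintype.card (box d (n + 1)) + (box d n).card ≤
      Fintype.card (ContractedVertex (boxBoundary d (n + 1))) + (box d (n + 1)).card := by
  classical
  have hb : ∀ x : box d (n + 1), x ∈ boxBoundary d (n + 1) → x.1 ∉ box d n := by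
    rintro x ⟨e, ⟨he, he'⟩ | ⟨he, he'⟩⟩ hx <;> refine he' (mem_box.2 fun i => ?_) <;>
      have h1 := mem_box.1 (he ▸ hx) i <;> have h2 := hi_apply e i <;> split_ifs at h2 <;>
      push_cast <;> omega
  have h : Fintype.card (box d (n + 1)) ≤
      Fintype.card (ContractedVertex (boxBoundary d (n + 1)) ⊕ ↥(box d (n + 1) \ box d n)) := by
    refine Fintype.card_le_of_injective (fun x => if h : x ∈ boxBoundary d (n + 1) then
      Sum.inr ⟨x.1, Finset.mem_sdiff.2 ⟨x.2, hb x h⟩⟩ else Sum.inl (Quotient.mk _ x)) ?_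
    intro x y hxy
    dsimp only at hxy
    split_ifs at hxy with hx hy hy
    · have h := Sum.inr.inj hxy
      exact Subtype.ext (Subtype.mk.inj h)
    · rcases Quotient.exact (Sum.inl.inj hxy) with h | h
      · exact h
      · exact absurd h.1 hx
  rw [Fintype.card_sum, Fintype.card_coe (_ \ _),
    Finset.card_sdiff_of_subset (box_mono (n.le_add_right 1))] at h
  have := Finset.card_le_card (box_mono (d := d) (n.le_add_right 1))
  omega

end Boxes

/-! ### Local limits -/

section LocalLimits

variable {E : Type*}

/-- The event that all edges of `T` are hard. -/
def hardEvent (T : Finset E) : Set (Config E) := {κ | ∀ e ∈ T, κ e = true}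

theorem measurableSet_hardEvent (T : Finset E) : MeasurableSet (hardEvent T) := by
  have : hardEvent T = ⋂ e ∈ T, (fun κ : Config E => κ e) ⁻¹' {true} := by
    ext κ
    simp [hardEvent]
  rw [this]
  exact T.measurableSet_biInter fun e _ => measurable_pi_apply e (MeasurableSet.singleton true)

theorem isPiSystem_hardEvent : IsPiSystem (Set.range (hardEvent (E := E))) := by
  classical
  rintro _ ⟨S, rfl⟩ _ ⟨T, rfl⟩ _
  refine ⟨S ∪ T, ?_⟩
  ext κ
  simp [hardEvent, or_imp, forall_and]

theorem generateFrom_hardEvent :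
    MeasurableSpace.generateFrom (Set.range (hardEvent (E := E))) = MeasurableSpace.pi := by
  refine le_antisymm (MeasurableSpace.generateFrom_le ?_) (iSup_le fun e => ?_)
  · rintro _ ⟨T, rfl⟩
    exact measurableSet_hardEvent T
  · rw [← measurable_iff_comap_le]
    refine @measurable_to_bool _ (MeasurableSpace.generateFrom _) _ ?_
    refine MeasurableSpace.measurableSet_generateFrom ⟨{e}, ?_⟩
    ext κ
    simp [hardEvent]

theorem measure_ext_of_hardEvent {μ ν : Measure (Config E)} [IsProbabilityMeasure μ]
    [IsProbabilityMeasure ν] (h : ∀ T, μ (hardEvent T) = ν (hardEvent T)) : μ = ν :=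
  ext_of_generate_finite _ generateFrom_hardEvent.symm isPiSystem_hardEvent
    (by rintro _ ⟨T, rfl⟩; exact h T) (by simp)

theorem isLocalEvent_hardEvent (T : Finset E) : IsLocalEvent (hardEvent T) := by
  refine ⟨T, ?_⟩
  have : hardEvent T = ⋂ e ∈ T, (fun κ : Config E => κ e) ⁻¹' {true} := by
    ext κ
    simp [hardEvent]
  rw [this]
  exact T.measurableSet_biInter fun e he => measurable_cylinderEvent_apply he
    (MeasurableSet.singleton true)

/-- A local event is pulled back from a finite discrete space. Its empty frontier makes weak
convergence imply local convergence. -/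
theorem IsLocalEvent.isClopen {A : Set (Config E)} (hA : IsLocalEvent A) : IsClopen A := by
  obtain ⟨F, hF⟩ := hA
  have hle : cylinderEvents (X := fun _ : E => Bool) (F : Set E) ≤
      MeasurableSpace.comap F.restrict ⊤ := by
    refine iSup₂_le fun e he => ?_
    have : (fun κ : Config E => κ e) = (fun η : F → Bool => η ⟨e, he⟩) ∘ F.restrict := rfl
    rw [this, ← MeasurableSpace.comap_comp]
    exact MeasurableSpace.comap_mono le_top
  obtain ⟨B, -, rfl⟩ := hle A hF
  exact (isClopen_discrete B).preimage (by fun_prop)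

/-- Probability measures on the compact space of configurations converge along every ultrafilter.
Hard events form a generating π-system, so their convergent probabilities force all these limits to
agree. -/
theorem existsUnique_localTendsto [Countable E] (ν : ℕ → Measure (Config E))
    [∀ n, IsProbabilityMeasure (ν n)]
    (h : ∀ T, ∃ a, Tendsto (fun n => ν n (hardEvent T)) atTop (𝓝 a)) :
    ∃! μ, IsProbabilityMeasure μ ∧ LocalTendsto ν μ := by
  let P : ℕ → ProbabilityMeasure (Config E) := fun n => ⟨ν n, inferInstance⟩
  have hlim : ∀ U : Ultrafilter ℕ, ∃ μ : ProbabilityMeasure (Config E), ∀ A, IsLocalEvent A →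
      Tendsto (fun n => ν n A) U (𝓝 ((μ : Measure (Config E)) A)) := by
    intro U
    refine ⟨(U.map P).lim, fun A hA => ?_⟩
    have hU : Tendsto P U (𝓝 (U.map P).lim) := (U.map P).le_nhds_lim
    exact ProbabilityMeasure.tendsto_measure_of_null_frontier_of_tendsto' hU
      (by simp [hA.isClopen.frontier_eq])
  choose μ hμ using hlim
  choose a ha using h
  have hval : ∀ U : Ultrafilter ℕ, ↑U ≤ (atTop : Filter ℕ) → ∀ T,
      (μ U : Measure (Config E)) (hardEvent T) = a T := fun U hU T =>
    tendsto_nhds_unique (hμ U _ (isLocalEvent_hardEvent T)) ((ha T).mono_left hU)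
  refine ⟨μ (hyperfilter ℕ), ⟨inferInstance, fun A hA => ?_⟩, fun ν' hν' => ?_⟩
  · rw [tendsto_iff_ultrafilter]
    intro U hU
    have : (μ U : Measure (Config E)) = μ (hyperfilter ℕ) := measure_ext_of_hardEvent fun T =>
      (hval U hU T).trans (hval _ Nat.hyperfilter_le_atTop T).symm
    exact this ▸ hμ U A hA
  · have := hν'.1
    exact measure_ext_of_hardEvent fun T =>
      (tendsto_nhds_unique (hν'.2 _ (isLocalEvent_hardEvent T)) (ha T)).trans
        (hval _ Nat.hyperfilter_le_atTop T).symm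

end LocalLimits

/-! ### Finite measures as probability measures -/

section FiniteVolume

variable {V E : Type*} [Fintype V] [Fintype E] [DecidableEq E] {G : Multigraph V E} {q p : ℝ}

theorem isProbabilityMeasure_finiteMeasure (hG : G.IsConnected) (hq : 1 ≤ q) (hp : 0 ≤ p)
    (hp' : p ≤ 1) : IsProbabilityMeasure (finiteMeasure G q p) := by
  have hZ := partition_pos hG hq hp hp'
  refine ⟨?_⟩
  simp only [finiteMeasure, Measure.coe_finsetSum, Finset.sum_apply, Measure.smul_apply,
    measure_univ, smul_eq_mul, mul_one]
  change ∑ κ, ENNReal.ofReal (weight G q p κ / partition G q p) = 1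
  rw [← ENNReal.ofReal_sum_of_nonneg fun κ _ => div_nonneg (weight_nonneg G q hp hp' κ) hZ.le,
    ← Finset.sum_div]
  exact (congrArg _ (div_self hZ.ne')).trans ENNReal.ofReal_one

theorem finiteMeasure_hardEvent (hG : G.IsConnected) (hq : 1 ≤ q) (hp : 0 ≤ p)
    (hp' : p ≤ 1) (T : Finset E) :
    finiteMeasure G q p (hardEvent T) = ENNReal.ofReal (hardProb G q p T) := by
  have hZ := partition_pos hG hq hp hp'
  simp only [finiteMeasure, Measure.coe_finsetSum, Finset.sum_apply, Measure.smul_apply,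
    Measure.dirac_apply' _ (measurableSet_hardEvent T), smul_eq_mul]
  rw [hardProb, Finset.sum_div, ENNReal.ofReal_sum_of_nonneg]
  · refine Finset.sum_congr rfl fun κ _ => ?_
    by_cases h : ∀ e ∈ T, κ e = true
    · rw [if_pos h, Set.indicator_of_mem (show κ ∈ hardEvent T from h), Pi.one_apply, mul_one]
      rfl
    · rw [if_neg h, Set.indicator_of_notMem (show κ ∉ hardEvent T from h)]
      simp
  · intro κ _
    refine div_nonneg ?_ hZ.le
    split_ifs
    exacts [weight_nonneg G q hp hp' κ, le_rfl]

theorem measurable_softExtension {d n : ℕ} : Measurable (softExtension (d := d) (n := n)) := by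
  refine measurable_pi_iff.2 fun e => ?_
  unfold softExtension
  split_ifs
  · exact measurable_pi_apply _
  · exact measurable_const

end FiniteVolume

/-! ### Monotonicity in the box and existence of the limits -/

section InfiniteVolume

variable {d : ℕ} {q p : ℝ}

theorem softExtension_preimage_hardEvent {n : ℕ} (T : Finset (boxBonds d n)) :
    softExtension ⁻¹' hardEvent (T.map (.subtype _)) = hardEvent T := by
  ext κ
  simp only [hardEvent, softExtension, Set.mem_preimage, Set.mem_ofPred_eq, Finset.mem_map,
    Function.Embedding.subtype_apply, forall_exists_index, and_imp, forall_apply_eq_imp_iff₂]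
  exact forall₂_congr fun e _ => by simp

theorem isProbabilityMeasure_freeMeasure (d : ℕ) (hq : 1 ≤ q) (hp : 0 ≤ p) (hp' : p ≤ 1) (n : ℕ) :
    IsProbabilityMeasure (freeMeasure d q p n) :=
  have := isProbabilityMeasure_finiteMeasure (freeGraph_isConnected d n) hq hp hp'
  Measure.isProbabilityMeasure_map measurable_softExtension.aemeasurable

theorem isProbabilityMeasure_wiredMeasure (d : ℕ) (hq : 1 ≤ q) (hp : 0 ≤ p) (hp' : p ≤ 1)
    (n : ℕ) : IsProbabilityMeasure (wiredMeasure d q p n) :=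
  have := isProbabilityMeasure_finiteMeasure (wiredGraph_isConnected d n) hq hp hp'
  Measure.isProbabilityMeasure_map measurable_softExtension.aemeasurable

theorem freeMeasure_hardEvent (hq : 1 ≤ q) (hp : 0 ≤ p) (hp' : p ≤ 1) {n : ℕ}
    (T : Finset (boxBonds d n)) : freeMeasure d q p n (hardEvent (T.map (.subtype _))) =
      ENNReal.ofReal (hardProb (freeGraph d n) q p T) := by
  rw [freeMeasure, Measure.map_apply measurable_softExtension (measurableSet_hardEvent _),
    softExtension_preimage_hardEvent,
    finiteMeasure_hardEvent (freeGraph_isConnected d n) hq hp hp']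

theorem wiredMeasure_hardEvent (hq : 1 ≤ q) (hp : 0 ≤ p) (hp' : p ≤ 1) {n : ℕ}
    (T : Finset (boxBonds d n)) : wiredMeasure d q p n (hardEvent (T.map (.subtype _))) =
      ENNReal.ofReal (hardProb (wiredGraph d n) q p T) := by
  rw [wiredMeasure, Measure.map_apply measurable_softExtension (measurableSet_hardEvent _),
    softExtension_preimage_hardEvent,
    finiteMeasure_hardEvent (wiredGraph_isConnected d n) hq hp hp']

theorem map_boxBond_map_subtype (g : LatticeAut d) {n m : ℕ}
    (hg : ∀ x ∈ box d n, g.vert x ∈ box d m) (T : Finset (boxBonds d n)) :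
    (T.map (g.boxBond hg)).map (.subtype _) =
      (T.map (.subtype _)).map g.bond.toEmbedding := by
  rw [Finset.map_map, Finset.map_map]
  rfl

theorem freeMeasure_hardEvent_le (hq : 1 ≤ q) (hp : 0 ≤ p) (hp' : p ≤ 1) (g : LatticeAut d)
    {n m : ℕ} (hg : ∀ x ∈ box d n, g.vert x ∈ box d m) {T : Finset (Bond d)}
    (hT : T ⊆ boxBonds d n) :
    freeMeasure d q p n (hardEvent T) ≤
      freeMeasure d q p m (hardEvent (T.map g.bond.toEmbedding)) := by
  obtain ⟨T, rfl⟩ : ∃ T' : Finset (boxBonds d n), T'.map (.subtype _) = T :=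
    ⟨_, Finset.subtype_map_of_mem hT⟩
  rw [← map_boxBond_map_subtype g hg, freeMeasure_hardEvent hq hp hp',
    freeMeasure_hardEvent hq hp hp']
  exact ENNReal.ofReal_le_ofReal (hardProb_freeGraph_le hq hp hp' g hg T)

theorem wiredMeasure_hardEvent_le (hd : 1 ≤ d) (hq : 1 ≤ q) (hp : 0 ≤ p) (hp' : p ≤ 1)
    (g : LatticeAut d) {n m : ℕ} (hg : ∀ x ∈ box d n, g.vert x ∈ box d m) {T : Finset (Bond d)}
    (hT : T ⊆ boxBonds d n) :
    wiredMeasure d q p m (hardEvent (T.map g.bond.toEmbedding)) ≤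
      wiredMeasure d q p n (hardEvent T) := by
  obtain ⟨T, rfl⟩ : ∃ T' : Finset (boxBonds d n), T'.map (.subtype _) = T :=
    ⟨_, Finset.subtype_map_of_mem hT⟩
  rw [← map_boxBond_map_subtype g hg, wiredMeasure_hardEvent hq hp hp',
    wiredMeasure_hardEvent hq hp hp']
  exact ENNReal.ofReal_le_ofReal (hardProb_wiredGraph_le hd hq hp hp' g hg T)

theorem boxBonds_mono {n m : ℕ} (h : n ≤ m) : boxBonds d n ⊆ boxBonds d m := fun _ he =>
  mem_boxBonds.2 ⟨box_mono h (mem_boxBonds.1 he).1, box_mono h (mem_boxBonds.1 he).2⟩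

theorem exists_subset_boxBonds (T : Finset (Bond d)) : ∃ N, T ⊆ boxBonds d N := by
  classical
  induction T using Finset.induction_on with
  | empty => exact ⟨0, by simp⟩
  | insert e T _ ih =>
    obtain ⟨N, hN⟩ := ih
    obtain ⟨k, hk⟩ := exists_mem_box e.lo
    obtain ⟨l, hl⟩ := exists_mem_box e.hi
    refine ⟨max N (max k l), Finset.insert_subset (mem_boxBonds.2 ⟨?_, ?_⟩)
      (hN.trans (boxBonds_mono (le_max_left _ _)))⟩
    · exact box_mono (by omega) hk
    · exact box_mono (by omega) hl

theorem freeMeasure_hardEvent_mono (hq : 1 ≤ q) (hp : 0 ≤ p) (hp' : p ≤ 1) {T : Finset (Bond d)}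
    {n m : ℕ} (hT : T ⊆ boxBonds d n) (h : n ≤ m) :
    freeMeasure d q p n (hardEvent T) ≤ freeMeasure d q p m (hardEvent T) := by
  have := freeMeasure_hardEvent_le hq hp hp' (.refl d) (m := m) (fun x hx => box_mono h hx) hT
  rwa [show T.map (LatticeAut.refl d).bond.toEmbedding = T from Finset.map_refl] at this

theorem wiredMeasure_hardEvent_anti (hd : 1 ≤ d) (hq : 1 ≤ q) (hp : 0 ≤ p) (hp' : p ≤ 1)
    {T : Finset (Bond d)} {n m : ℕ} (hT : T ⊆ boxBonds d n) (h : n ≤ m) :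
    wiredMeasure d q p m (hardEvent T) ≤ wiredMeasure d q p n (hardEvent T) := by
  have := wiredMeasure_hardEvent_le hd hq hp hp' (.refl d) (m := m)
    (fun x hx => box_mono h hx) hT
  rwa [show T.map (LatticeAut.refl d).bond.toEmbedding = T from Finset.map_refl] at this

theorem existsUnique_isFreeLimit (d : ℕ) (hq : 1 ≤ q) (hp : 0 ≤ p) (hp' : p ≤ 1) :
    ∃! μ, IsFreeLimit d q p μ := by
  have := isProbabilityMeasure_freeMeasure d hq hp hp'
  refine existsUnique_localTendsto (freeMeasure d q p) fun T => ?_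
  obtain ⟨N, hN⟩ := exists_subset_boxBonds T
  -- The shift by `N` is needed because monotonicity is available only once the box contains `T`.
  refine ⟨_, (tendsto_add_atTop_iff_nat N).1 (tendsto_atTop_iSup ?_)⟩
  exact fun n m h => freeMeasure_hardEvent_mono hq hp hp' (hN.trans (boxBonds_mono (by omega)))
    (by omega)

theorem existsUnique_isWiredLimit (hd : 1 ≤ d) (hq : 1 ≤ q) (hp : 0 ≤ p) (hp' : p ≤ 1) :
    ∃! μ, IsWiredLimit d q p μ := by
  have := isProbabilityMeasure_wiredMeasure d hq hp hp'
  refine existsUnique_localTendsto (wiredMeasure d q p) fun T => ?_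
  obtain ⟨N, hN⟩ := exists_subset_boxBonds T
  refine ⟨_, (tendsto_add_atTop_iff_nat N).1 (tendsto_atTop_iInf ?_)⟩
  exact fun n m h => wiredMeasure_hardEvent_anti hd hq hp hp'
    (hN.trans (boxBonds_mono (by omega))) (by omega)

theorem IsFreeLimit.freeMeasure_le (hq : 1 ≤ q) (hp : 0 ≤ p) (hp' : p ≤ 1)
    {μ : Measure (Config (Bond d))} (hμ : IsFreeLimit d q p μ) {n : ℕ} {T : Finset (Bond d)}
    (hT : T ⊆ boxBonds d n) : freeMeasure d q p n (hardEvent T) ≤ μ (hardEvent T) :=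
  ge_of_tendsto (hμ.2 _ (isLocalEvent_hardEvent T)) <| (eventually_ge_atTop n).mono fun _ hm =>
    freeMeasure_hardEvent_mono hq hp hp' hT hm

theorem IsWiredLimit.le_wiredMeasure (hd : 1 ≤ d) (hq : 1 ≤ q) (hp : 0 ≤ p) (hp' : p ≤ 1)
    {μ : Measure (Config (Bond d))} (hμ : IsWiredLimit d q p μ) {n : ℕ} {T : Finset (Bond d)}
    (hT : T ⊆ boxBonds d n) : μ (hardEvent T) ≤ wiredMeasure d q p n (hardEvent T) :=
  le_of_tendsto (hμ.2 _ (isLocalEvent_hardEvent T)) <| (eventually_ge_atTop n).mono fun _ hm =>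
    wiredMeasure_hardEvent_anti hd hq hp hp' hT hm

end InfiniteVolume

/-! ### Comparison of the edge densities -/

section Density

variable {V₁ V₂ E : Type*} [Fintype V₁] [Fintype V₂] [Fintype E]
  {G₁ : Multigraph V₁ E} {G₂ : Multigraph V₂ E} {q p p' : ℝ}

theorem detLaplacian_smul (G : Multigraph V₁ E) (q : ℝ) (c : E → ℝ) :
    detLaplacian G (q • c) = q ^ Module.finrank ℝ (zeroSum V₁) * detLaplacian G c := by
  rw [detLaplacian_eq, detLaplacian_eq, ← LinearMap.det_smul]
  congr 1
  refine LinearMap.ext fun f => Subtype.ext (funext fun x => ?_)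
  simp only [LinearMap.smul_apply, Submodule.coe_smul, coe_laplacianZero, Pi.smul_apply, laplacian,
    LinearMap.coe_mk, AddHom.coe_mk, smul_eq_mul, Finset.mul_sum, mul_assoc]

theorem finrank_zeroSum_add_one (V : Type*) [Fintype V] [Nonempty V] :
    Module.finrank ℝ (zeroSum V) + 1 = Fintype.card V := by
  classical
  let s : Module.Dual ℝ (V → ℝ) := ∑ x, LinearMap.proj x
  have hs : ∀ f, s f = ∑ x, f x := fun f => by simp [s]
  have hker : LinearMap.ker s = zeroSum V := by
    ext f
    rw [LinearMap.mem_ker, hs]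
    rfl
  have hne : s ≠ 0 := fun h => by
    obtain ⟨x⟩ := ‹Nonempty V›
    have := hs (Pi.single x 1)
    simp [h] at this
  rw [← hker, Module.Dual.finrank_ker_add_one_of_ne_zero hne, Module.finrank_fintype_fun_eq_card]

/-- Identifying vertices preserves the energy of pulled-back functions, so the determinant
comparison applies: the ratio of the determinants of `G₁` and `G₂` is nondecreasing in `κ`. -/
theorem detLaplacian_mul_le_of_le (hG₁ : G₁.IsConnected) (hG₂ : G₂.IsConnected) (hq : 1 ≤ q)
    (φ : V₁ → V₂) (ht : ∀ e, φ (G₁.tail e) = G₂.tail e) (hh : ∀ e, φ (G₁.head e) = G₂.head e)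
    {κ κ' : Config E} (hκ : κ ≤ κ') :
    detLaplacian G₂ (conductance q κ') * detLaplacian G₁ (conductance q κ) ≤
      detLaplacian G₁ (conductance q κ') * detLaplacian G₂ (conductance q κ) := by
  classical
  have h : IsHardening κ κ' (.refl E) (Finset.univ.filter fun e => κ' e = true ∧ κ e = false) := by
    refine ⟨fun e he => by simp_all, fun e => ?_⟩
    have : κ e = true → κ' e = true := fun h => top_le_iff.1 (h.ge.trans (hκ e))
    cases h : κ e <;> cases h' : κ' e <;> simp_all
  have := detLaplacian_mul_le_of_energy_le hG₁ hG₂ (conductance_pos hq κ) (conductance_pos hq κ) φ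
    (fun f => by simp [energy, ht, hh]) id id ht hh (sub_nonneg.2 hq)
    (Finset.univ.filter fun e => κ' e = true ∧ κ e = false)
  rw [h.conductance_eq]
  exact this

/-- The monotone ratio of determinants lies between its all-soft and all-hard values. These differ
by a scaling of all conductances by `q`, which changes the ratio by at most $q^K$. -/
theorem detLaplacian_mul_le_pow_mul [Nonempty V₁] [Nonempty V₂] (hG₁ : G₁.IsConnected)
    (hG₂ : G₂.IsConnected) (hq : 1 ≤ q) (φ : V₁ → V₂) (ht : ∀ e, φ (G₁.tail e) = G₂.tail e)
    (hh : ∀ e, φ (G₁.head e) = G₂.head e) {K : ℕ}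
    (hK : Fintype.card V₁ ≤ Fintype.card V₂ + K) (κ κ' : Config E) :
    detLaplacian G₁ (conductance q κ) * detLaplacian G₂ (conductance q κ') ≤
      q ^ K * (detLaplacian G₁ (conductance q κ') * detLaplacian G₂ (conductance q κ)) := by
  have hq0 : 0 < q := by linarith
  have hpos₁ : ∀ κ : Config E, 0 < detLaplacian G₁ (conductance q κ) := fun κ =>
    detLaplacian_pos hG₁ (conductance_pos hq κ)
  have hpos₂ : ∀ κ : Config E, 0 < detLaplacian G₂ (conductance q κ) := fun κ =>
    detLaplacian_pos hG₂ (conductance_pos hq κ)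
  have hmono : ∀ {κ κ' : Config E}, κ ≤ κ' →
      detLaplacian G₁ (conductance q κ) / detLaplacian G₂ (conductance q κ) ≤
      detLaplacian G₁ (conductance q κ') / detLaplacian G₂ (conductance q κ') := by
    intro κ κ' h
    rw [div_le_div_iff₀ (hpos₂ _) (hpos₂ _), mul_comm]
    exact detLaplacian_mul_le_of_le hG₁ hG₂ hq φ ht hh h
  have htop : conductance q (⊤ : Config E) = q • conductance q (⊥ : Config E) := by
    funext e
    simp [conductance]
  have hscale : detLaplacian G₁ (conductance q (⊤ : Config E)) /
      detLaplacian G₂ (conductance q (⊤ : Config E)) ≤ q ^ K *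
      (detLaplacian G₁ (conductance q (⊥ : Config E)) /
        detLaplacian G₂ (conductance q (⊥ : Config E))) := by
    rw [htop, detLaplacian_smul, detLaplacian_smul, mul_div_mul_comm]
    refine mul_le_mul_of_nonneg_right ?_ (div_pos (hpos₁ _) (hpos₂ _)).le
    rw [div_le_iff₀ (pow_pos hq0 _), ← pow_add]
    refine pow_le_pow_right₀ hq ?_
    have h1 := finrank_zeroSum_add_one V₁
    have h2 := finrank_zeroSum_add_one V₂
    omega
  have h := (hmono (le_top (a := κ))).trans (hscale.trans
    (mul_le_mul_of_nonneg_left (hmono (bot_le (a := κ'))) (pow_pos hq0 K).le))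
  rw [mul_div_assoc', div_le_div_iff₀ (hpos₂ _) (hpos₂ _)] at h
  linarith

/-- Tilting by the odds ratio turns Bernoulli weights at `p` into those at `p'`, up to a factor
depending only on the number of edges. -/
theorem pow_mul_pow_tilt (hp : 0 < p) (hp1' : p' < 1) (h s : ℕ) :
    (p' * (1 - p) / ((1 - p') * p)) ^ h * (p ^ h * (1 - p) ^ s) =
      p' ^ h * (1 - p') ^ s * ((1 - p) / (1 - p')) ^ (h + s) := by
  have h1 : (1 - p') ≠ 0 := (sub_pos.2 hp1').ne'
  have h2 : p' * (1 - p) / ((1 - p') * p) * p = p' * ((1 - p) / (1 - p')) := by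
    field_simp
  have h3 : (1 - p) = (1 - p') * ((1 - p) / (1 - p')) := by
    field_simp
  calc _ = (p' * (1 - p) / ((1 - p') * p) * p) ^ h * (1 - p) ^ s := by rw [mul_pow]; ring
    _ = (p' * ((1 - p) / (1 - p'))) ^ h * ((1 - p') * ((1 - p) / (1 - p'))) ^ s := by
      rw [h2, ← h3]
    _ = _ := by rw [mul_pow, mul_pow, pow_add]; ring

variable [DecidableEq E]

theorem sum_hardProb_singleton (G : Multigraph V₁ E) (q p : ℝ) :
    ∑ e, hardProb G q p {e} = ∑ κ : Config E, weight G q p κ / partition G q p * hardCount κ := by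
  simp only [hardProb, ← Finset.sum_div, Finset.mem_singleton, forall_eq]
  rw [Finset.sum_comm, Finset.sum_div]
  refine Finset.sum_congr rfl fun κ _ => ?_
  rw [Finset.sum_ite, Finset.sum_const_zero, add_zero, Finset.sum_const, nsmul_eq_mul, hardCount]
  ring

/-- Jensen's inequality for the number of hard edges, whose mean is the sum of the edge
probabilities. -/
theorem exp_sum_hardProb_le {G : Multigraph V₁ E} (hG : G.IsConnected) (hq : 1 ≤ q) (hp : 0 ≤ p)
    (hp' : p ≤ 1) (t : ℝ) : Real.exp (t * ∑ e, hardProb G q p {e}) ≤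
      (∑ κ : Config E, weight G q p κ * Real.exp (t * hardCount κ)) / partition G q p := by
  have hZ := partition_pos hG hq hp hp'
  have := convexOn_exp.map_sum_le (t := Finset.univ)
    (w := fun κ : Config E => weight G q p κ / partition G q p)
    (p := fun κ => t * (hardCount κ : ℝ))
    (fun κ _ => div_nonneg (weight_nonneg G q hp hp' κ) hZ.le)
    (by rw [← Finset.sum_div]; exact div_self hZ.ne') (fun _ _ => Set.mem_univ _)
  rw [sum_hardProb_singleton, Finset.mul_sum, Finset.sum_div]
  refine le_of_eq_of_le (congrArg _ ?_) (this.trans (le_of_eq ?_))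
  · exact Finset.sum_congr rfl fun κ _ => by rw [smul_eq_mul]; ring
  · exact Finset.sum_congr rfl fun κ _ => by rw [smul_eq_mul]; ring

/-- If the vertices of `G₁` are identified to obtain `G₂` and at most `K` of them are lost, then
the expected number of hard edges on `G₂` exceeds that on `G₁`, at a larger parameter, by at most a
multiple of `K`. -/
theorem sum_hardProb_sub_le [Nonempty V₁] [Nonempty V₂] (hG₁ : G₁.IsConnected)
    (hG₂ : G₂.IsConnected) (hq : 1 ≤ q) (hp : 0 < p) (hpp' : p < p') (hp' : p' < 1)
    (φ : V₁ → V₂) (ht : ∀ e, φ (G₁.tail e) = G₂.tail e) (hh : ∀ e, φ (G₁.head e) = G₂.head e)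
    {K : ℕ} (hK : Fintype.card V₁ ≤ Fintype.card V₂ + K) :
    Real.log (p' * (1 - p) / ((1 - p') * p)) *
      (∑ e, hardProb G₂ q p {e} - ∑ e, hardProb G₁ q p' {e}) ≤ K * (Real.log q / 2) := by
  have hp0' : 0 < p' := hp.trans hpp'
  have hp1 : p < 1 := hpp'.trans hp'
  have h1p : 0 < 1 - p := sub_pos.2 hp1
  have h1p' : 0 < 1 - p' := sub_pos.2 hp'
  set θ := p' * (1 - p) / ((1 - p') * p) with hθ
  have hθ0 : 0 < θ := by positivity
  have hexp : ∀ κ : Config E, Real.exp (Real.log θ * hardCount κ) = θ ^ hardCount κ := fun κ => by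
    rw [mul_comm, Real.exp_nat_mul, Real.exp_log hθ0]
  have hZ₁ := partition_pos hG₁ hq hp0'.le hp'.le
  have hZ₂ := partition_pos hG₂ hq hp.le hp1.le
  -- The tilts exchange `p` and `p'` between the two configurations, and the edge-count factors
  -- cancel. Only the oscillation of the determinant ratio remains.
  have hterm : ∀ κ κ' : Config E,
      weight G₂ q p κ * Real.exp (Real.log θ * hardCount κ) *
        (weight G₁ q p' κ' * Real.exp (-Real.log θ * hardCount κ')) ≤
      √(q ^ K) * (weight G₁ q p' κ * weight G₂ q p κ') := by
    intro κ κ'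
    have e1 := pow_mul_pow_tilt hp hp' (hardCount κ) (softCount κ)
    have e2 := pow_mul_pow_tilt hp hp' (hardCount κ') (softCount κ')
    rw [hardCount_add_softCount, ← hθ] at e1 e2
    have hnum : p ^ hardCount κ * (1 - p) ^ softCount κ * θ ^ hardCount κ *
        (p' ^ hardCount κ' * (1 - p') ^ softCount κ' * (θ ^ hardCount κ')⁻¹) =
        p' ^ hardCount κ * (1 - p') ^ softCount κ *
          (p ^ hardCount κ' * (1 - p) ^ softCount κ') := by
      have hθn : θ ^ hardCount κ' * (θ ^ hardCount κ')⁻¹ = 1 := mul_inv_cancel₀ (by positivity)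
      clear_value θ
      generalize ((1 - p) / (1 - p')) ^ Fintype.card E = ρ at e1 e2
      linear_combination (p' ^ hardCount κ' * (1 - p') ^ softCount κ' * (θ ^ hardCount κ')⁻¹) * e1 -
        (p' ^ hardCount κ * (1 - p') ^ softCount κ * (θ ^ hardCount κ')⁻¹) * e2 +
        (p' ^ hardCount κ * (1 - p') ^ softCount κ *
          (p ^ hardCount κ' * (1 - p) ^ softCount κ')) * hθn
    have hD₁ := detLaplacian_pos hG₁ (conductance_pos hq κ)
    have hD₂ := detLaplacian_pos hG₂ (conductance_pos hq κ)
    have hD₁' := detLaplacian_pos hG₁ (conductance_pos hq κ')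
    have hD₂' := detLaplacian_pos hG₂ (conductance_pos hq κ')
    have hD := Real.sqrt_le_sqrt (detLaplacian_mul_le_pow_mul hG₁ hG₂ hq φ ht hh hK κ κ')
    rw [Real.sqrt_mul hD₁.le, Real.sqrt_mul (by positivity), Real.sqrt_mul hD₁'.le] at hD
    rw [neg_mul, Real.exp_neg, hexp, hexp]
    unfold weight
    have hfrac : ∀ a b x y t i : ℝ, a / x * t * (b / y * i) = a * t * (b * i) / (x * y) := by
      intros
      ring
    rw [hfrac, div_mul_div_comm, hnum,
      mul_div_assoc', div_le_div_iff₀ (by positivity) (by positivity)]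
    have hN : 0 ≤ p' ^ hardCount κ * (1 - p') ^ softCount κ *
      (p ^ hardCount κ' * (1 - p) ^ softCount κ') := by positivity
    have := mul_le_mul_of_nonneg_left hD hN
    linarith
  have hsum : (∑ κ : Config E, weight G₂ q p κ * Real.exp (Real.log θ * hardCount κ)) *
      (∑ κ : Config E, weight G₁ q p' κ * Real.exp (-Real.log θ * hardCount κ)) ≤
      √(q ^ K) * (partition G₁ q p' * partition G₂ q p) := by
    unfold partition
    rw [Finset.sum_mul_sum, Finset.sum_mul_sum, Finset.mul_sum]
    refine Finset.sum_le_sum fun κ _ => ?_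
    rw [Finset.mul_sum]
    exact Finset.sum_le_sum fun κ' _ => hterm κ κ'
  have h₂ := exp_sum_hardProb_le hG₂ hq hp.le hp1.le (Real.log θ)
  have h₁ := exp_sum_hardProb_le hG₁ hq hp0'.le hp'.le (-Real.log θ)
  -- Opposite signs of $\log\theta$ in the two Jensen bounds produce the difference of the means.
  have h := mul_le_mul h₂ h₁ (Real.exp_pos _).le ((Real.exp_pos _).le.trans h₂)
  rw [← Real.exp_add, div_mul_div_comm] at h
  have hbound := h.trans ((div_le_iff₀ (mul_pos hZ₂ hZ₁)).2
    (by rwa [mul_comm (partition G₂ q p)]) : _ ≤ √(q ^ K))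
  have hq0 : 0 < q := by linarith
  have := (Real.le_log_iff_exp_le (Real.sqrt_pos.2 (pow_pos hq0 K))).2 hbound
  rw [Real.log_sqrt (pow_pos hq0 K).le, Real.log_pow] at this
  linarith

theorem hardProb_singleton_zero (G : Multigraph V₁ E) (q : ℝ) (e : E) :
    hardProb G q 0 {e} = 0 := by
  rw [hardProb, Finset.sum_eq_zero, zero_div]
  intro κ _
  rw [ite_eq_right_iff]
  intro h
  have : hardCount κ ≠ 0 := by
    rw [hardCount, ← Nat.pos_iff_ne_zero, Finset.card_pos]
    exact ⟨e, by simpa using h⟩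
  simp [weight, this]

theorem hardProb_singleton_one {G : Multigraph V₁ E} (hG : G.IsConnected) (hq : 1 ≤ q) (e : E) :
    hardProb G q 1 {e} = 1 := by
  rw [hardProb, div_eq_one_iff_eq (partition_pos hG hq zero_le_one le_rfl).ne', partition]
  refine Finset.sum_congr rfl fun κ _ => ?_
  rw [ite_eq_left_iff]
  intro h
  have : softCount κ ≠ 0 := by
    rw [softCount, ← Nat.pos_iff_ne_zero, Finset.card_pos]
    exact ⟨e, by simpa using h⟩
  simp [weight, this]

end Density

/-! ### Comparison of the limiting densities -/

section Limits

variable {d : ℕ} {q p p' : ℝ} {μ₀ μ₁ : Measure (Config (Bond d))}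

theorem bond_mem_boxBonds (g : LatticeAut d) {n m : ℕ} (hg : ∀ x ∈ box d n, g.vert x ∈ box d m)
    {e : Bond d} (he : e ∈ boxBonds d n) : g.bond e ∈ boxBonds d m :=
  (g.boxBond hg ⟨e, he⟩).2

/-- An automorphism moves `e'` to `e` and the box into a larger one, where free probabilities only
grow. The bound thus holds even for edges near the boundary. -/
theorem IsFreeLimit.hardProb_le (hq : 1 ≤ q) (hp : 0 ≤ p) (hp' : p ≤ 1)
    (hμ : IsFreeLimit d q p μ₀) {n : ℕ} (e' : boxBonds d n) (e : Bond d) :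
    hardProb (freeGraph d n) q p {e'} ≤ μ₀.real (hardEvent {e}) := by
  have := hμ.1
  obtain ⟨N, hN⟩ := exists_latticeAut e
  obtain ⟨g, rfl, hg⟩ := hN n e'.1 e'.2
  have h1 := freeMeasure_hardEvent_le hq hp hp' g hg (T := {e'.1}) (by simp)
  rw [Finset.map_singleton] at h1
  have h2 := h1.trans (hμ.freeMeasure_le hq hp hp'
    (Finset.singleton_subset_iff.2 (bond_mem_boxBonds g hg e'.2)))
  rw [show ({e'.1} : Finset (Bond d)) = Finset.map (.subtype _) {e'} from rfl,
    freeMeasure_hardEvent hq hp hp'] at h2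
  exact (ENNReal.ofReal_le_iff_le_toReal (measure_ne_top _ _)).1 h2

theorem IsWiredLimit.le_hardProb (hd : 1 ≤ d) (hq : 1 ≤ q) (hp : 0 ≤ p) (hp' : p ≤ 1)
    (hμ : IsWiredLimit d q p μ₁) {n : ℕ} (e' : boxBonds d n) (e : Bond d) :
    μ₁.real (hardEvent {e}) ≤ hardProb (wiredGraph d n) q p {e'} := by
  have := hμ.1
  obtain ⟨N, hN⟩ := exists_latticeAut e
  obtain ⟨g, rfl, hg⟩ := hN n e'.1 e'.2
  have h1 := wiredMeasure_hardEvent_le hd hq hp hp' g hg (T := {e'.1}) (by simp)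
  rw [Finset.map_singleton] at h1
  have h2 := (hμ.le_wiredMeasure hd hq hp hp'
    (Finset.singleton_subset_iff.2 (bond_mem_boxBonds g hg e'.2))).trans h1
  rw [show ({e'.1} : Finset (Bond d)) = Finset.map (.subtype _) {e'} from rfl,
    wiredMeasure_hardEvent hq hp hp'] at h2
  refine ENNReal.toReal_le_of_le_ofReal (div_nonneg (Finset.sum_nonneg fun κ _ => ?_)
    (partition_pos (wiredGraph_isConnected d n) hq hp hp').le) h2
  split_ifs
  exacts [weight_nonneg _ q hp hp' κ, le_rfl]

theorem tendsto_card_box_div (d : ℕ) :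
    Tendsto (fun n : ℕ => ((box d (n + 1)).card : ℝ) / (box d n).card - 1) atTop (𝓝 0) := by
  have h : Tendsto (fun n : ℕ => (1 + 2 / (2 * (n : ℝ) + 1)) ^ d - 1) atTop (𝓝 ((1 + 0) ^ d - 1)) :=
    (((Tendsto.const_div_atTop (tendsto_atTop_add_const_right _ _
      (tendsto_natCast_atTop_atTop.const_mul_atTop two_pos)) _).const_add 1).pow d).sub_const 1
  rw [add_zero, one_pow, sub_self] at h
  refine h.congr fun n => ?_
  rw [card_box, card_box]
  push_cast
  rw [← div_pow]
  congr 2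
  field_simp
  ring

/-- A positive gap `x` would occur at every edge of the box, while the total excess is bounded by
the number of lost vertices; surface over volume tends to zero. -/
theorem real_hardEvent_le_of_pos_of_lt_one (hd : 1 ≤ d) (hq : 1 ≤ q) (hp : 0 < p) (hpp' : p < p')
    (hp' : p' < 1) (hμ₀ : IsFreeLimit d q p' μ₀) (hμ₁ : IsWiredLimit d q p μ₁) (e : Bond d) :
    μ₁.real (hardEvent {e}) ≤ μ₀.real (hardEvent {e}) := by
  set δ := Real.log (p' * (1 - p) / ((1 - p') * p)) with hδ
  have h1p' : 0 < 1 - p' := sub_pos.2 hp'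
  have hδ0 : 0 < δ := Real.log_pos (by
    rw [one_lt_div (by positivity)]
    nlinarith)
  by_contra! hlt
  set x := μ₁.real (hardEvent {e}) - μ₀.real (hardEvent {e}) with hx
  have hx0 : 0 < x := sub_pos.2 hlt
  have hbound : ∀ n : ℕ, δ * x ≤
      (((box d (n + 1)).card : ℝ) / (box d n).card - 1) * (Real.log q / 2) := by
    intro n
    have hcard : 0 < ((box d n).card : ℝ) := by
      rw [card_box]
      positivity
    have hmono := Finset.card_le_card (box_mono (d := d) (n.le_add_right 1))
    have : Nonempty (box d (n + 1)) := ⟨⟨0, mem_box.2 fun i => by simp; omega⟩⟩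
    have : Nonempty (ContractedVertex (boxBoundary d (n + 1))) := ⟨Quotient.mk _ (Classical.arbitrary _)⟩
    have hK := card_le_card_contractedVertex_add d n
    have h := sum_hardProb_sub_le (freeGraph_isConnected d (n + 1))
      (wiredGraph_isConnected d (n + 1)) hq hp hpp' hp' (Quotient.mk _) (fun _ => rfl)
      (fun _ => rfl) (K := (box d (n + 1)).card - (box d n).card) (by omega)
    rw [← hδ, ← Finset.sum_sub_distrib, Nat.cast_sub hmono] at h
    have hsum : (boxBonds d (n + 1)).card * x ≤
        ∑ e', (hardProb (wiredGraph d (n + 1)) q p {e'} -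
          hardProb (freeGraph d (n + 1)) q p' {e'}) := by
      rw [← Fintype.card_coe, ← nsmul_eq_mul, ← Finset.card_univ]
      refine Finset.card_nsmul_le_sum _ _ _ fun e' _ => sub_le_sub ?_ ?_
      · exact hμ₁.le_hardProb hd hq hp.le (hpp'.trans hp').le e' e
      · exact hμ₀.hardProb_le hq (hp.trans hpp').le hp'.le e' e
    have hcc : ((box d n).card : ℝ) ≤ (boxBonds d (n + 1)).card := by
      exact_mod_cast card_box_le_card_boxBonds hd n
    have h2 : δ * ((box d n).card * x) ≤
        (((box d (n + 1)).card : ℝ) - (box d n).card) * (Real.log q / 2) :=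
      (mul_le_mul_of_nonneg_left ((mul_le_mul_of_nonneg_right hcc hx0.le).trans hsum) hδ0.le).trans h
    rw [div_sub_one hcard.ne', div_mul_eq_mul_div, le_div_iff₀ hcard]
    linarith
  have hlim := (tendsto_card_box_div d).mul_const (Real.log q / 2)
  rw [zero_mul] at hlim
  exact (mul_pos hδ0 hx0).not_ge (ge_of_tendsto' hlim hbound)

theorem real_hardEvent_le (hd : 1 ≤ d) (hq : 1 ≤ q) (hp : 0 ≤ p) (hpp' : p < p')
    (hp' : p' ≤ 1) (hμ₀ : IsFreeLimit d q p' μ₀) (hμ₁ : IsWiredLimit d q p μ₁) (e : Bond d) :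
    μ₁.real (hardEvent {e}) ≤ μ₀.real (hardEvent {e}) := by
  have := hμ₁.1
  obtain ⟨n, hn⟩ := exists_subset_boxBonds {e}
  let e' : boxBonds d n := ⟨e, Finset.singleton_subset_iff.1 hn⟩
  -- At $p=0$ or $p'=1$ the odds ratio degenerates, but all edges are then soft, respectively hard.
  rcases hp.eq_or_lt with rfl | hp0
  · have := hμ₁.le_hardProb hd hq le_rfl zero_le_one e' e
    rw [hardProb_singleton_zero] at this
    exact this.trans measureReal_nonneg
  · rcases hp'.eq_or_lt with rfl | hp1
    · have := hμ₀.hardProb_le hq zero_le_one le_rfl e' e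
      rw [hardProb_singleton_one (freeGraph_isConnected d n) hq] at this
      exact measureReal_le_one.trans this
    · exact real_hardEvent_le_of_pos_of_lt_one hd hq hp0 hpp' hp1 hμ₀ hμ₁ e

end Limits

end RandomConductance

theorem mainTheorem10 (d : ℕ) (hd : 1 ≤ d) (q : ℝ) (hq : 1 ≤ q) (p p' : ℝ)
    (hp : 0 ≤ p) (hpp' : p < p') (hp' : p' ≤ 1) :
    (∃! μ₀ : Measure (RandomConductance.Config (RandomConductance.Bond d)),
      RandomConductance.IsFreeLimit d q p' μ₀) ∧
    (∃! μ₁ : Measure (RandomConductance.Config (RandomConductance.Bond d)),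
      RandomConductance.IsWiredLimit d q p μ₁) ∧
    ∀ μ₀ μ₁ : Measure (RandomConductance.Config (RandomConductance.Bond d)),
      RandomConductance.IsFreeLimit d q p' μ₀ → RandomConductance.IsWiredLimit d q p μ₁ →
      ∀ e : RandomConductance.Bond d, μ₁ {κ | κ e = true} ≤ μ₀ {κ | κ e = true} := by
  refine ⟨RandomConductance.existsUnique_isFreeLimit d hq (hp.trans hpp'.le) hp',
    RandomConductance.existsUnique_isWiredLimit hd hq hp (hpp'.le.trans hp'),
    fun μ₀ μ₁ h₀ h₁ e => ?_⟩
  have := h₀.1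
  have := h₁.1
  have h := RandomConductance.real_hardEvent_le hd hq hp hpp' hp' h₀ h₁ e
  have he : RandomConductance.hardEvent {e} = {κ | κ e = true} := by
    ext κ
    simp [RandomConductance.hardEvent]
  rw [he] at h
  exact (ENNReal.toReal_le_toReal (measure_ne_top _ _) (measure_ne_top _ _)).1 h
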